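/- For complex $q$ with $|q|<1$ let $$\varphi(q)=\sum_{n=-\infty}^{\infty}q^{n^2},\qquad \psi(q)=\sum_{n=-\infty}^{\infty}q^{2n^2-n},$$ and let $\left(\frac{n}{5}\right)$ denote the Legendre symbol modulo $5$ (equal to $0$ if $5\mid n$). Then for every complex $q$ with $|q|<1$ all the series below converge absolutely, and $$\varphi(q)\varphi^3(q^5)=1+\sum_{n=1}^{\infty}\left(\frac n5\right)\frac{nq^n}{1-(-q)^n}-\sum_{n=1}^{\infty}\left(\frac n5\right)\frac{(-q)^n}{(1+(-q)^n)^2},$$ $$\varphi^3(q)\varphi(q^5)=1+\sum_{n=1}^{\infty}\left(\frac n5\right)\frac{nq^n}{1-(-q)^n}-5\sum_{n=1}^{\infty}\left(\frac n5\right)\frac{(-q)^n}{(1+(-q)^n)^2},$$ $$4q\psi^3(q)\psi(q^5)=-\sum_{n=1}^{\infty}\left(\frac n5\right)\frac{nq^n}{1-q^{2n}}+5\sum_{\substack{n=1\\ n\text{ odd}}}^{\infty}\left(\frac n5\right)\frac{q^n}{(1-q^n)^2},$$ $$4q^2\psi(q)\psi^3(q^5)=-\sum_{n=1}^{\infty}\left(\frac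 n5\right)\frac{nq^n}{1-q^{2n}}+\sum_{\substack{n=1\\ n\text{ odd}}}^{\infty}\left(\frac n5\right)\frac{q^n}{(1-q^n)^2}.$$ -/

import Mathlib

/-- The `n`-th term of Ramanujan's general theta series,
`a ^ (n (n + 1) / 2) * b ^ (n (n - 1) / 2)`. Both integer divisions are exact and both
exponents are nonnegative for every integer `n`. -/
noncomputable def ramanujanThetaTerm (a b : ℂ) (n : ℤ) : ℂ :=
  a ^ (n * (n + 1) / 2) * b ^ (n * (n - 1) / 2)

/-- Ramanujan's general theta function `f(a, b)`, for `|a b| < 1`. -/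
noncomputable def ramanujanTheta (a b : ℂ) : ℂ :=
  ∑' n : ℤ, ramanujanThetaTerm a b n

/-- Ramanujan's `φ(q) = f(q, q)`, the sum of `q ^ (n ^ 2)` over all integers `n`. -/
noncomputable def ramanujanPhi (q : ℂ) : ℂ := ramanujanTheta q q

/-- Ramanujan's `ψ(q) = f(q, q ^ 3)`, the sum of `q ^ (2 n ^ 2 - n)` over all integers `n`. -/
noncomputable def ramanujanPsi (q : ℂ) : ℂ := ramanujanTheta q (q ^ 3)

instance fact_prime_five_nat : Fact (Nat.Prime 5) := ⟨by norm_num⟩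

/-- The Legendre symbol `(n / 5)`, as a complex number. -/
def legendreFive (n : ℕ) : ℂ := ((legendreSym 5 (n : ℤ) : ℤ) : ℂ)

/-!
The Jacobi triple product turns `φ` and `ψ` into quotients of Euler products
`E(q ^ k) = (q ^ k; q ^ k)_∞`. Differentiating Weierstrass's three-term theta relation at a double
zero expresses the difference of two values of the sum `∑ t / (1 - t) ^ 2` over
`t = x p ^ n`, `n ∈ ℤ`, which is `℘` up to a constant, as a theta quotient. Each of the four series
twisted by `(n / 5)` is such a difference: for the series with `1 / (1 ± q ^ n) ^ 2` split `n` into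
residue classes, for the series with the factor `n` write `(n / 5)` as a Gauss sum over the fifth
roots of unity. Hence every series is a quotient of Euler products, and the four identities reduce
to the product formulas for `ψ(q) ^ 2 - q ψ(q ^ 5) ^ 2` and `ψ(q) ^ 2 - 5 q ψ(q ^ 5) ^ 2`, two more
instances of the three-term relation.
-/

open Filter Finset Topology

/-- The infinite `q`-Pochhammer symbol `(a; p)_∞`, meaningful for `‖p‖ < 1`. -/
noncomputable def qPochhammer (a p : ℂ) : ℂ := ∏' n : ℕ, (1 - a * p ^ n)

lemma norm_pow_lt_one {p : ℂ} (hp : ‖p‖ < 1) (k : ℕ) [NeZero k] : ‖p ^ k‖ < 1 := by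
  rw [norm_pow]
  exact pow_lt_one₀ (norm_nonneg p) hp (NeZero.ne k)

lemma summable_mul_pow {p : ℂ} (hp : ‖p‖ < 1) (a : ℂ) : Summable fun n : ℕ => a * p ^ n :=
  (summable_geometric_of_norm_lt_one hp).mul_left a

lemma multipliable_one_sub_mul_pow {p : ℂ} (hp : ‖p‖ < 1) (a : ℂ) :
    Multipliable fun n : ℕ => 1 - a * p ^ n := by
  simpa only [sub_eq_add_neg] using
    multipliable_one_add_of_summable (summable_mul_pow hp a).neg.norm

lemma tendsto_prod_qPochhammer {p : ℂ} (hp : ‖p‖ < 1) (a : ℂ) :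
    Tendsto (fun N : ℕ => ∏ k ∈ range N, (1 - a * p ^ k)) atTop (𝓝 (qPochhammer a p)) :=
  (multipliable_one_sub_mul_pow hp a).hasProd.tendsto_prod_nat

lemma qPochhammer_ne_zero_iff {p : ℂ} (hp : ‖p‖ < 1) (a : ℂ) :
    qPochhammer a p ≠ 0 ↔ ∀ n : ℕ, 1 - a * p ^ n ≠ 0 := by
  refine ⟨fun h n hn => h (tprod_of_exists_eq_zero ⟨n, hn⟩), fun h => ?_⟩
  simp only [sub_eq_add_neg] at h
  simpa only [qPochhammer, sub_eq_add_neg] using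
    tprod_one_add_ne_zero_of_summable h (summable_mul_pow hp a).neg.norm

lemma one_sub_mul_pow_ne_zero {a p : ℂ} (ha : ‖a‖ < 1) (hp : ‖p‖ < 1) (n : ℕ) :
    1 - a * p ^ n ≠ 0 := by
  have hlt : ‖a * p ^ n‖ < 1 := by
    rw [norm_mul, norm_pow]
    exact mul_lt_one_of_nonneg_of_lt_one_left (norm_nonneg a) ha
      (pow_le_one₀ (norm_nonneg p) hp.le)
  intro h
  rw [← sub_eq_zero.mp h, norm_one] at hlt
  exact hlt.false

/-- Euler's product `(q; q)_∞`, up to a power of `q` the Dedekind eta function. -/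
noncomputable def eulerProd (q : ℂ) : ℂ := qPochhammer q q

lemma eulerProd_ne_zero {q : ℂ} (hq : ‖q‖ < 1) : eulerProd q ≠ 0 :=
  (qPochhammer_ne_zero_iff hq q).mpr (one_sub_mul_pow_ne_zero hq hq)

lemma qPochhammer_eq_one_sub_mul {p : ℂ} (hp : ‖p‖ < 1) (a : ℂ) :
    qPochhammer a p = (1 - a) * qPochhammer (a * p) p := by
  rw [qPochhammer, tprod_eq_zero_mul']
  · simp only [qPochhammer, pow_zero, mul_one, pow_succ', mul_assoc]
  · simpa only [pow_succ', mul_assoc] using multipliable_one_sub_mul_pow hp (a * p)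

lemma qPochhammer_eq_prod_residues {p : ℂ} (hp : ‖p‖ < 1) (a : ℂ) (k : ℕ) [NeZero k] :
    qPochhammer a p = ∏ r ∈ range k, qPochhammer (a * p ^ r) (p ^ k) := by
  have hsub := (tendsto_prod_qPochhammer hp a).comp
    (tendsto_id.const_mul_atTop' (NeZero.pos k))
  have hres := tendsto_finsetProd (range k) fun r _ =>
    tendsto_prod_qPochhammer (norm_pow_lt_one hp k) (a * p ^ r)
  refine tendsto_nhds_unique hsub (hres.congr fun N => ?_)
  simp only [Function.comp, id]
  induction N with
  | zero => simp
  | succ N ih =>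
    rw [mul_add_one, prod_range_add, ← ih, ← prod_mul_distrib]
    refine prod_congr rfl fun r _ => ?_
    rw [prod_range_succ]
    ring

lemma prod_qPochhammer_rootsOfUnity {ζ p : ℂ} {n : ℕ} [NeZero n] (hζ : IsPrimitiveRoot ζ n)
    (hp : ‖p‖ < 1) (a : ℂ) :
    ∏ k ∈ range n, qPochhammer (ζ ^ k * a) p = qPochhammer (a ^ n) (p ^ n) := by
  have hfactor (t : ℂ) : ∏ k ∈ range n, (1 - ζ ^ k * t) = 1 - t ^ n := by
    simpa [Polynomial.eval_prod] using
      (congrArg (Polynomial.eval 1) (X_pow_sub_C_eq_prod hζ (NeZero.pos n) (rfl : t ^ n = _))).symm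
  simp only [qPochhammer]
  rw [← Multipliable.tprod_finsetProd fun k _ => multipliable_one_sub_mul_pow hp (ζ ^ k * a)]
  refine tprod_congr fun j => ?_
  simp only [mul_assoc, hfactor, mul_pow, pow_right_comm p j n]

lemma qPochhammer_mul_neg {p : ℂ} (hp : ‖p‖ < 1) (a : ℂ) :
    qPochhammer a p * qPochhammer (-a) p = qPochhammer (a ^ 2) (p ^ 2) := by
  simpa [prod_range_succ] using
    prod_qPochhammer_rootsOfUnity (IsPrimitiveRoot.neg_one 0 two_ne_zero.symm) hp a

/-! ### Theta products and theta series -/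

/-- The theta product `(x; p)_∞ (p / x; p)_∞`. -/
noncomputable def thetaProd (x p : ℂ) : ℂ := qPochhammer x p * qPochhammer (p / x) p

/-- The `n`-th term of the theta series `∑ (-x) ^ n p ^ (n (n - 1) / 2)`, whose sum is
`(p; p)_∞ (x; p)_∞ (p / x; p)_∞`; the integer division is exact. -/
noncomputable def thetaTerm (x p : ℂ) (n : ℤ) : ℂ := (-x) ^ n * p ^ (n * (n - 1) / 2)

lemma triangle_succ (n : ℤ) : (n + 1) * n / 2 = n * (n - 1) / 2 + n := by
  rw [show (n + 1) * n = n * (n - 1) + n * 2 by ring, Int.add_mul_ediv_right _ _ two_ne_zero]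

lemma triangle_mul_two (n : ℤ) : n * (n - 1) / 2 * 2 = n * (n - 1) :=
  Int.ediv_mul_cancel (by simpa using (Int.even_mul_pred_self n).two_dvd)

lemma thetaTerm_succ {x p : ℂ} (hx : x ≠ 0) (hp : p ≠ 0) (n : ℤ) :
    thetaTerm x p (n + 1) = -x * p ^ n * thetaTerm x p n := by
  rw [thetaTerm, thetaTerm, add_sub_cancel_right, triangle_succ, zpow_add₀ hp,
    zpow_add_one₀ (neg_ne_zero.mpr hx)]
  ring

lemma thetaTerm_ne_zero {x p : ℂ} (hx : x ≠ 0) (hp : p ≠ 0) (n : ℤ) : thetaTerm x p n ≠ 0 :=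
  mul_ne_zero (zpow_ne_zero _ (neg_ne_zero.mpr hx)) (zpow_ne_zero _ hp)

lemma thetaTerm_neg (x : ℂ) {p : ℂ} (hp : p ≠ 0) (n : ℤ) :
    thetaTerm x p (-n) = thetaTerm (p / x) p n := by
  rw [thetaTerm, thetaTerm, show -n * (-n - 1) = (n + 1) * n by ring, triangle_succ,
    zpow_add₀ hp, zpow_neg, ← inv_zpow, inv_neg, show -(p / x) = -x⁻¹ * p by ring, mul_zpow]
  ring

lemma summable_thetaTerm_natCast {x p : ℂ} (hx : x ≠ 0) (hp : p ≠ 0) (hp1 : ‖p‖ < 1) :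
    Summable fun n : ℕ => thetaTerm x p n := by
  have hratio (n : ℕ) : ‖thetaTerm x p (n + 1 : ℕ)‖ / ‖thetaTerm x p n‖ = ‖x‖ * ‖p‖ ^ n := by
    rw [Nat.cast_succ, thetaTerm_succ hx hp, norm_mul,
      mul_div_cancel_right₀ _ (norm_ne_zero_iff.mpr (thetaTerm_ne_zero hx hp n))]
    simp
  refine summable_of_ratio_test_tendsto_lt_one one_pos
    (Eventually.of_forall fun n => thetaTerm_ne_zero hx hp _) ?_
  simp only [hratio]
  simpa using (tendsto_pow_atTop_nhds_zero_of_lt_one (norm_nonneg p) hp1).const_mul ‖x‖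

lemma summable_thetaTerm {x p : ℂ} (hx : x ≠ 0) (hp : p ≠ 0) (hp1 : ‖p‖ < 1) :
    Summable (thetaTerm x p) := by
  refine Summable.of_nat_of_neg (summable_thetaTerm_natCast hx hp hp1) ?_
  simpa only [thetaTerm_neg x hp] using
    summable_thetaTerm_natCast (div_ne_zero hp hx) hp hp1

/-- The reciprocal `1 / (p; p)_n` of the finite `q`-Pochhammer symbol, extended by zero to negative
`n` so that the recurrence `invPochhammer_succ` holds for every integer. -/
noncomputable def invPochhammer (p : ℂ) (n : ℤ) : ℂ :=
  if n < 0 then 0 else (∏ k ∈ range n.toNat, (1 - p * p ^ k))⁻¹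

lemma invPochhammer_of_neg (p : ℂ) {n : ℤ} (hn : n < 0) : invPochhammer p n = 0 := if_pos hn

lemma invPochhammer_natCast (p : ℂ) (n : ℕ) :
    invPochhammer p n = (∏ k ∈ range n, (1 - p * p ^ k))⁻¹ := by
  simp [invPochhammer]

lemma invPochhammer_succ {p : ℂ} (hp : ‖p‖ < 1) (n : ℤ) :
    (1 - p ^ (n + 1)) * invPochhammer p (n + 1) = invPochhammer p n := by
  rcases lt_trichotomy n (-1) with h | rfl | h
  · rw [invPochhammer_of_neg p (by lia), invPochhammer_of_neg p (by lia), mul_zero]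
  · simp [invPochhammer_of_neg]
  · obtain ⟨m, rfl⟩ := Int.eq_ofNat_of_zero_le (show 0 ≤ n by lia)
    rw [← Nat.cast_succ, invPochhammer_natCast, invPochhammer_natCast, prod_range_succ, mul_inv_rev,
      zpow_natCast, pow_succ', mul_inv_cancel_left₀ (one_sub_mul_pow_ne_zero hp hp m)]

lemma tendsto_invPochhammer {p : ℂ} (hp : ‖p‖ < 1) :
    Tendsto (invPochhammer p) atTop (𝓝 (eulerProd p)⁻¹) := by
  rw [← Nat.map_cast_int_atTop, tendsto_map'_iff]
  simpa only [Function.comp_def, invPochhammer_natCast, eulerProd] using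
    (tendsto_prod_qPochhammer hp p).inv₀ (eulerProd_ne_zero hp)

lemma exists_norm_invPochhammer_le {p : ℂ} (hp : ‖p‖ < 1) : ∃ M, ∀ n, ‖invPochhammer p n‖ ≤ M := by
  obtain ⟨M, hM⟩ := (Metric.isBounded_range_of_tendsto _
    ((tendsto_invPochhammer hp).comp tendsto_natCast_atTop_atTop)).exists_norm_le
  refine ⟨M, fun n => ?_⟩
  rcases lt_or_ge n 0 with h | h
  · rw [invPochhammer_of_neg p h, norm_zero]
    exact (norm_nonneg _).trans (hM _ ⟨0, rfl⟩)
  · obtain ⟨m, rfl⟩ := Int.eq_ofNat_of_zero_le h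
    exact hM _ ⟨m, rfl⟩

/-- The central Gaussian binomial coefficient `[2N choose N + j]_p`, zero for `N < |j|`. These are
the coefficients of the finite form of the Jacobi triple product. -/
noncomputable def gaussBinom (p : ℂ) (N : ℕ) (j : ℤ) : ℂ :=
  (∏ k ∈ range (2 * N), (1 - p * p ^ k)) * (invPochhammer p (N - j) * invPochhammer p (N + j))

lemma gaussBinom_zero (p : ℂ) (j : ℤ) : gaussBinom p 0 j = if j = 0 then 1 else 0 := by
  rcases lt_trichotomy j 0 with h | rfl | h
  · simp [gaussBinom, invPochhammer_of_neg, h, h.ne]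
  · simp [gaussBinom, invPochhammer]
  · simp [gaussBinom, invPochhammer_of_neg, h, h.ne']

lemma gaussBinom_succ {p : ℂ} (hp : p ≠ 0) (hp1 : ‖p‖ < 1) (N : ℕ) (j : ℤ) :
    gaussBinom p (N + 1) j = (1 + p ^ (2 * N + 1)) * gaussBinom p N j +
      p ^ (N - j + 1) * gaussBinom p N (j - 1) + p ^ (N + j + 1) * gaussBinom p N (j + 1) := by
  have hsub := invPochhammer_succ hp1 (N - j)
  have hsub' := invPochhammer_succ hp1 (N - j - 1)
  have hadd := invPochhammer_succ hp1 (N + j)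
  have hadd' := invPochhammer_succ hp1 (N + j - 1)
  have hpow : p ^ (2 * N) = p ^ ((N : ℤ) - j) * p ^ ((N : ℤ) + j) := by
    rw [← zpow_add₀ hp, ← zpow_natCast]
    congr 1
    push_cast
    ring
  rw [sub_add_cancel] at hsub' hadd'
  rw [gaussBinom, gaussBinom, gaussBinom, gaussBinom, Nat.cast_succ, add_sub_right_comm,
    add_right_comm, sub_sub_eq_add_sub, add_sub_right_comm, ← add_sub_assoc, sub_add_eq_sub_sub,
    ← add_assoc, ← hsub', ← hadd', ← hsub, ← hadd, mul_add_one, prod_range_succ, prod_range_succ,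
    pow_succ, hpow, zpow_add_one₀ hp, zpow_add_one₀ hp]
  ring

lemma hasSum_gaussBinom_mul_thetaTerm {x p : ℂ} (hx : x ≠ 0) (hp : p ≠ 0) (hp1 : ‖p‖ < 1)
    (N : ℕ) :
    HasSum (fun j : ℤ => gaussBinom p N j * thetaTerm x p j)
      ((∏ k ∈ range N, (1 - x * p ^ k)) * ∏ k ∈ range N, (1 - p / x * p ^ k)) := by
  induction N with
  | zero =>
    have hterm (j : ℤ) : gaussBinom p 0 j * thetaTerm x p j = if j = 0 then 1 else 0 := by
      rcases eq_or_ne j 0 with rfl | h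
      · simp [gaussBinom_zero, thetaTerm]
      · simp [gaussBinom_zero, h]
    simpa only [hterm, prod_range_zero, mul_one] using hasSum_ite_eq (0 : ℤ) (1 : ℂ)
  | succ N ih =>
    have hterm (j : ℤ) : gaussBinom p (N + 1) j * thetaTerm x p j =
        (1 + p ^ (2 * N + 1)) * (gaussBinom p N j * thetaTerm x p j) -
          p ^ N * x * (gaussBinom p N (j - 1) * thetaTerm x p (j - 1)) -
          p ^ (N + 1) / x * (gaussBinom p N (j + 1) * thetaTerm x p (j + 1)) := by
      have hprev := thetaTerm_succ hx hp (j - 1)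
      rw [sub_add_cancel, zpow_sub_one₀ hp] at hprev
      have hj := zpow_ne_zero j hp
      rw [gaussBinom_succ hp hp1, thetaTerm_succ hx hp j, hprev, zpow_add_one₀ hp,
        zpow_add_one₀ hp, zpow_add₀ hp, zpow_sub₀ hp, zpow_natCast]
      field_simp
      ring
    have hprod (P Q : ℂ) : P * (1 - x * p ^ N) * (Q * (1 - p / x * p ^ N)) =
        (1 + p ^ (2 * N + 1)) * (P * Q) - p ^ N * x * (P * Q) - p ^ (N + 1) / x * (P * Q) := by
      field_simp
      ring
    rw [prod_range_succ, prod_range_succ, hprod, funext hterm]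
    exact ((ih.mul_left _).sub (((Equiv.subRight (1 : ℤ)).hasSum_iff.mpr ih).mul_left _)).sub
      (((Equiv.addRight (1 : ℤ)).hasSum_iff.mpr ih).mul_left _)

/-- The Jacobi triple product identity. -/
theorem tsum_thetaTerm {x p : ℂ} (hx : x ≠ 0) (hp : p ≠ 0) (hp1 : ‖p‖ < 1) :
    ∑' n : ℤ, thetaTerm x p n = eulerProd p * thetaProd x p := by
  obtain ⟨M, hM⟩ := exists_norm_invPochhammer_le hp1
  obtain ⟨K, hK⟩ :=
    (Metric.isBounded_range_of_tendsto _ (tendsto_prod_qPochhammer hp1 p)).exists_norm_le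
  have hcoeff (j : ℤ) : Tendsto (gaussBinom p · j) atTop (𝓝 (eulerProd p)⁻¹) := by
    have hprod : Tendsto _ _ (𝓝 (eulerProd p)) := (tendsto_prod_qPochhammer hp1 p).comp
      (tendsto_id.const_mul_atTop' (two_pos : (0 : ℕ) < 2))
    have hshift (i : ℤ) :=
      (tendsto_invPochhammer hp1).comp
        (tendsto_atTop_add_const_right _ i (tendsto_natCast_atTop_atTop (R := ℤ)))
    simpa [gaussBinom, Function.comp_def, sub_eq_add_neg, eulerProd_ne_zero hp1] using
      hprod.mul ((hshift (-j)).mul (hshift j))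
  have hlim := tendsto_tsum_of_dominated_convergence
    (bound := fun j => K * (M * M) * ‖thetaTerm x p j‖)
    ((summable_thetaTerm hx hp hp1).norm.mul_left _)
    (fun j => (hcoeff j).mul_const (thetaTerm x p j)) <| Eventually.of_forall fun N j => by
      have hK' := hK _ ⟨2 * N, rfl⟩
      have hK0 := (norm_nonneg _).trans hK'
      rw [gaussBinom, norm_mul, norm_mul, norm_mul]
      gcongr
      · exact (norm_nonneg _).trans (hM 0)
      · exact hM _
      · exact hM _
  simp only [(hasSum_gaussBinom_mul_thetaTerm hx hp hp1 _).tsum_eq, tsum_mul_left] at hlim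
  rw [thetaProd, tendsto_nhds_unique ((tendsto_prod_qPochhammer hp1 x).mul
    (tendsto_prod_qPochhammer hp1 (p / x))) hlim, mul_inv_cancel_left₀ (eulerProd_ne_zero hp1)]

lemma thetaProd_eq_of_mul_eq_nome {x y p : ℂ} (hp : p ≠ 0) (hxy : x * y = p) :
    thetaProd x p = thetaProd y p := by
  subst hxy
  rw [thetaProd, thetaProd, mul_div_cancel_left₀ y (left_ne_zero_of_mul hp),
    mul_div_cancel_right₀ x (right_ne_zero_of_mul hp), mul_comm]

lemma thetaProd_eq_of_mul_eq_one {x y p : ℂ} (hp : ‖p‖ < 1) (hxy : x * y = 1) :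
    thetaProd x p = -x * thetaProd y p := by
  obtain rfl := eq_inv_of_mul_eq_one_right hxy
  have hx := left_ne_zero_of_mul_eq_one hxy
  rw [thetaProd, thetaProd, qPochhammer_eq_one_sub_mul hp x, qPochhammer_eq_one_sub_mul hp x⁻¹,
    div_inv_eq_mul, inv_mul_eq_div, mul_comm p x]
  field_simp
  ring

/-! ### Products of two theta series -/

lemma tsum_int_prod_parity {E : Type*} [NormedAddCommGroup E] [CompleteSpace E] {f : ℤ × ℤ → E}
    (hf : Summable f) :
    ∑' z, f z = ∑' z : ℤ × ℤ, f (z.1 + 1 + z.2, z.1 + 1 - z.2) +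
      ∑' z : ℤ × ℤ, f (z.1 + 1 + z.2, z.1 - z.2) := by
  set e : ℤ × ℤ → ℤ × ℤ := fun z => (z.1 + 1 + z.2, z.1 + 1 - z.2)
  set o : ℤ × ℤ → ℤ × ℤ := fun z => (z.1 + 1 + z.2, z.1 - z.2)
  have he : e.Injective := by
    rintro ⟨a, b⟩ ⟨c, d⟩ h
    simp only [e, Prod.mk.injEq] at h ⊢
    lia
  have ho : o.Injective := by
    rintro ⟨a, b⟩ ⟨c, d⟩ h
    simp only [o, Prod.mk.injEq] at h ⊢
    lia
  have hcompl : IsCompl (Set.range e) (Set.range o) := by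
    refine ⟨Set.disjoint_iff.mpr ?_, codisjoint_iff_le_sup.mpr ?_⟩
    · rintro - ⟨⟨z, rfl⟩, ⟨w, h⟩⟩
      simp only [e, o, Prod.mk.injEq] at h
      exact absurd h (by lia)
    · rintro ⟨a, b⟩ -
      rcases Int.even_or_odd' (a + b) with ⟨c, h | h⟩
      · exact Or.inl ⟨(c - 1, a - c), by simp only [e, Prod.mk.injEq]; lia⟩
      · exact Or.inr ⟨(c, a - c - 1), by simp only [o, Prod.mk.injEq]; lia⟩
  exact (HasSum.add_isCompl hcompl
    (he.hasSum_range_iff.mpr (hf.comp_injective he).hasSum)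
    (ho.hasSum_range_iff.mpr (hf.comp_injective ho).hasSum)).tsum_eq

/-- The part `∑ p ^ (k ^ 2) y ^ (2 k)` of even powers of `y` in the theta series
`∑ p ^ (n ^ 2 / 4) y ^ n`. -/
noncomputable def evenTheta (p y : ℂ) : ℂ := ∑' k : ℤ, p ^ (k ^ 2) * y ^ (2 * k)

/-- The part of odd powers of `y` in the theta series `∑ p ^ (n ^ 2 / 4) y ^ n`, divided by
`p ^ (1 / 4)`. -/
noncomputable def oddTheta (p y : ℂ) : ℂ := ∑' k : ℤ, p ^ (k ^ 2 + k) * y ^ (2 * k + 1)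

lemma thetaTerm_sq (x p : ℂ) (k : ℤ) : thetaTerm x (p ^ 2) k = (-x) ^ k * p ^ (k * (k - 1)) := by
  rw [thetaTerm, ← zpow_natCast p 2, ← zpow_mul, mul_comm ((2 : ℕ) : ℤ), Nat.cast_ofNat,
    triangle_mul_two]

lemma summable_evenTheta {y p : ℂ} (hy : y ≠ 0) (hp : p ≠ 0) (hp1 : ‖p‖ < 1) :
    Summable fun k : ℤ => p ^ (k ^ 2) * y ^ (2 * k) := by
  refine (summable_thetaTerm (x := -(p * y ^ 2)) (by simp [hp, hy]) (pow_ne_zero 2 hp)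
    (norm_pow_lt_one hp1 2)).congr fun k => ?_
  rw [thetaTerm_sq, neg_neg, mul_zpow, show k ^ 2 = k + k * (k - 1) by ring, zpow_add₀ hp,
    zpow_mul y, zpow_ofNat]
  ring

lemma summable_oddTheta {y p : ℂ} (hy : y ≠ 0) (hp : p ≠ 0) (hp1 : ‖p‖ < 1) :
    Summable fun k : ℤ => p ^ (k ^ 2 + k) * y ^ (2 * k + 1) := by
  refine ((summable_thetaTerm (x := -(p ^ 2 * y ^ 2)) (by simp [hp, hy]) (pow_ne_zero 2 hp)
    (norm_pow_lt_one hp1 2)).mul_right y).congr fun k => ?_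
  rw [thetaTerm_sq, neg_neg, mul_zpow, show k ^ 2 + k = 2 * k + k * (k - 1) by ring,
    zpow_add₀ hp, zpow_mul p 2, zpow_add_one₀ hy, zpow_mul y, zpow_ofNat, zpow_ofNat]
  ring

lemma thetaTerm_mul_thetaTerm {x y p : ℂ} (hx : x ≠ 0) (hy : y ≠ 0) (hp : p ≠ 0) (m n : ℤ) :
    thetaTerm (x * y) p m * thetaTerm (x / y) p n =
      (-x) ^ (m + n) * y ^ (m - n) * p ^ (m * (m - 1) / 2 + n * (n - 1) / 2) := by
  rw [thetaTerm, thetaTerm, ← neg_mul, ← neg_div, mul_zpow, div_zpow, zpow_add₀ hp,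
    zpow_add₀ (neg_ne_zero.mpr hx), zpow_sub₀ hy]
  ring

lemma thetaTerm_mul_thetaTerm_even {x y p : ℂ} (hx : x ≠ 0) (hy : y ≠ 0) (hp : p ≠ 0) (j k : ℤ) :
    thetaTerm (x * y) p (j + 1 + k) * thetaTerm (x / y) p (j + 1 - k) =
      x * ((p ^ (j ^ 2 + j) * x ^ (2 * j + 1)) * (p ^ (k ^ 2) * y ^ (2 * k))) := by
  have hexp : (j + 1 + k) * (j + 1 + k - 1) / 2 + (j + 1 - k) * (j + 1 - k - 1) / 2 =
      j ^ 2 + j + k ^ 2 := by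
    apply mul_right_cancel₀ (two_ne_zero' ℤ)
    linear_combination triangle_mul_two (j + 1 + k) + triangle_mul_two (j + 1 - k)
  rw [thetaTerm_mul_thetaTerm hx hy hp, hexp, zpow_add₀ hp,
    show j + 1 + k + (j + 1 - k) = 2 * (j + 1) by ring,
    show j + 1 + k - (j + 1 - k) = 2 * k by ring, (even_two_mul (j + 1)).neg_zpow,
    show 2 * (j + 1) = 2 * j + 1 + 1 by ring, zpow_add_one₀ hx]
  ring

lemma thetaTerm_mul_thetaTerm_odd {x y p : ℂ} (hx : x ≠ 0) (hy : y ≠ 0) (hp : p ≠ 0) (j k : ℤ) :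
    thetaTerm (x * y) p (j + 1 + k) * thetaTerm (x / y) p (j - k) =
      -(x * ((p ^ (j ^ 2) * x ^ (2 * j)) * (p ^ (k ^ 2 + k) * y ^ (2 * k + 1)))) := by
  have hexp : (j + 1 + k) * (j + 1 + k - 1) / 2 + (j - k) * (j - k - 1) / 2 =
      j ^ 2 + (k ^ 2 + k) := by
    apply mul_right_cancel₀ (two_ne_zero' ℤ)
    linear_combination triangle_mul_two (j + 1 + k) + triangle_mul_two (j - k)
  rw [thetaTerm_mul_thetaTerm hx hy hp, hexp, zpow_add₀ hp,
    show j + 1 + k + (j - k) = 2 * j + 1 by ring, show j + 1 + k - (j - k) = 2 * k + 1 by ring,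
    zpow_add_one₀ (neg_ne_zero.mpr hx), (even_two_mul j).neg_zpow]
  ring

lemma eulerProd_sq_mul_thetaProd {x y p : ℂ} (hx : x ≠ 0) (hy : y ≠ 0) (hp : p ≠ 0)
    (hp1 : ‖p‖ < 1) :
    eulerProd p ^ 2 * (thetaProd (x * y) p * thetaProd (x / y) p) =
      x * (oddTheta p x * evenTheta p y - evenTheta p x * oddTheta p y) := by
  have hmul := (summable_thetaTerm (mul_ne_zero hx hy) hp hp1).norm
  have hdiv := (summable_thetaTerm (div_ne_zero hx hy) hp hp1).norm
  have hprod := summable_mul_of_summable_norm hmul hdiv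
  have hE {z : ℂ} (hz : z ≠ 0) := (summable_evenTheta hz hp hp1).norm
  have hO {z : ℂ} (hz : z ≠ 0) := (summable_oddTheta hz hp hp1).norm
  calc eulerProd p ^ 2 * (thetaProd (x * y) p * thetaProd (x / y) p)
      = (∑' n, thetaTerm (x * y) p n) * ∑' n, thetaTerm (x / y) p n := by
        rw [tsum_thetaTerm (mul_ne_zero hx hy) hp hp1, tsum_thetaTerm (div_ne_zero hx hy) hp hp1]
        ring
    _ = x * (oddTheta p x * evenTheta p y) + -(x * (evenTheta p x * oddTheta p y)) := by
        rw [tsum_mul_tsum_of_summable_norm hmul hdiv, tsum_int_prod_parity hprod]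
        simp only [thetaTerm_mul_thetaTerm_even hx hy hp, thetaTerm_mul_thetaTerm_odd hx hy hp,
          tsum_neg, tsum_mul_left]
        rw [← tsum_mul_tsum_of_summable_norm (hO hx) (hE hy),
          ← tsum_mul_tsum_of_summable_norm (hE hx) (hO hy), evenTheta, evenTheta, oddTheta,
          oddTheta]
    _ = x * (oddTheta p x * evenTheta p y - evenTheta p x * oddTheta p y) := by ring

/-- Weierstrass's three-term relation. -/
theorem thetaProd_three_term {x y u p : ℂ} (hx : x ≠ 0) (hy : y ≠ 0) (hu : u ≠ 0) (hp : p ≠ 0)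
    (hp1 : ‖p‖ < 1) :
    y * (thetaProd (x * y) p * thetaProd (x / y) p) * thetaProd u p ^ 2 +
      u * (thetaProd (y * u) p * thetaProd (y / u) p) * thetaProd x p ^ 2 +
      x * (thetaProd (u * x) p * thetaProd (u / x) p) * thetaProd y p ^ 2 = 0 := by
  have hE : eulerProd p ^ 2 ≠ 0 := pow_ne_zero 2 (eulerProd_ne_zero hp1)
  have hmul {a b : ℂ} (ha : a ≠ 0) (hb : b ≠ 0) :=
    eq_div_of_mul_eq hE ((mul_comm _ _).trans (eulerProd_sq_mul_thetaProd ha hb hp hp1))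
  have hsq {a : ℂ} (ha : a ≠ 0) := hmul ha one_ne_zero
  simp only [mul_one, div_one, ← sq] at hsq
  rw [hmul hx hy, hmul hy hu, hmul hu hx, hsq hx, hsq hy, hsq hu]
  ring

/-! ### Differences of values of `℘` -/

lemma hasDerivAt_tprod_one_add_mul {g : ℕ → ℂ} (hg : Summable g) :
    HasDerivAt (fun ε => ∏' n, (1 + ε * g n)) (∑' n, g n) 0 := by
  have h0 : (0 : ℂ) ∈ Metric.ball 0 1 := Metric.mem_ball_self one_pos
  have hterm (n : ℕ) : HasDerivAt (fun ε => 1 + ε * g n) (g n) 0 := by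
    simpa using ((hasDerivAt_id (0 : ℂ)).mul_const (g n)).const_add 1
  have hterm_log (n : ℕ) : logDeriv (fun ε => 1 + ε * g n) 0 = g n := by
    simp [logDeriv_apply, (hterm n).deriv]
  have hmult : MultipliableLocallyUniformlyOn (fun n ε => 1 + ε * g n) (Metric.ball 0 1) := by
    refine hg.norm.multipliableLocallyUniformlyOn_nat_one_add Metric.isOpen_ball
      (Eventually.of_forall fun n ε hε => ?_) fun n => by fun_prop
    rw [norm_mul]
    exact mul_le_of_le_one_left (norm_nonneg _) (mem_ball_zero_iff.mp hε).le
  have hdiff : DifferentiableOn ℂ (fun ε => ∏' n, (1 + ε * g n)) (Metric.ball 0 1) :=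
    hmult.hasProdLocallyUniformlyOn.differentiableOn
      (Eventually.of_forall fun _ => by
        simpa [Finset.prod_fn] using DifferentiableOn.finsetProd (fun _ _ => by fun_prop))
      Metric.isOpen_ball
  have hlog := logDeriv_tprod_eq_tsum Metric.isOpen_ball h0 (by simp) (fun n => by fun_prop)
    (by simpa only [hterm_log] using hg) hmult (by simp)
  simp only [hterm_log, logDeriv_apply, zero_mul, add_zero, tprod_one, div_one] at hlog
  simpa only [hlog] using (hdiff.differentiableAt (Metric.isOpen_ball.mem_nhds h0)).hasDerivAt

/-- The Koebe function `t / (1 - t) ^ 2`, the sum of `n t ^ n` for `‖t‖ < 1`. -/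
noncomputable def koebe (t : ℂ) : ℂ := t / (1 - t) ^ 2

lemma summable_koebe {p : ℂ} (hp : ‖p‖ < 1) (a : ℂ) : Summable fun n : ℕ => koebe (a * p ^ n) := by
  have hpow : Tendsto (fun n : ℕ => a * p ^ n) atTop (𝓝 0) := by
    simpa using (tendsto_pow_atTop_nhds_zero_of_norm_lt_one hp).const_mul a
  have hinv : Tendsto (fun n : ℕ => ‖((1 - a * p ^ n) ^ 2)⁻¹‖) atTop (𝓝 1) := by
    simpa using (((hpow.const_sub 1).pow 2).inv₀ (by norm_num)).norm
  refine Summable.of_norm_bounded_eventually_nat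
    (g := fun n : ℕ => 2 * ‖a * p ^ n‖) ((summable_mul_pow hp a).norm.mul_left 2) ?_
  filter_upwards [hinv.eventually_le_const one_lt_two] with n hn
  rw [koebe, div_eq_mul_inv, norm_mul, mul_comm]
  gcongr

/-- The sum of `x p ^ n / (1 - x p ^ n) ^ 2` over all integers `n`, which is Weierstrass's `℘` in
multiplicative form up to an additive constant. The terms with negative `n` are rewritten through
the symmetry `t ↦ 1 / t` of `koebe`. -/
noncomputable def koebeSum (x p : ℂ) : ℂ :=
  ∑' n : ℕ, koebe (x * p ^ n) + ∑' n : ℕ, koebe (p / x * p ^ n)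

/-- The product of `1 - ε a p ^ n / (1 - a p ^ n) ^ 2`, which for `ε = (v - 1) ^ 2 / v` equals
`(a v; p)_∞ (a / v; p)_∞ / (a; p)_∞ ^ 2`. -/
noncomputable def koebeProd (a p ε : ℂ) : ℂ := ∏' n : ℕ, (1 + ε * -koebe (a * p ^ n))

lemma koebeProd_zero (a p : ℂ) : koebeProd a p 0 = 1 := by simp [koebeProd]

lemma hasDerivAt_koebeProd (a : ℂ) {p : ℂ} (hp : ‖p‖ < 1) :
    HasDerivAt (koebeProd a p) (-∑' n : ℕ, koebe (a * p ^ n)) 0 := by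
  rw [← tsum_neg]
  exact hasDerivAt_tprod_one_add_mul (summable_koebe hp a).neg

lemma hasDerivAt_koebeProd_mul_koebeProd (x : ℂ) {p : ℂ} (hp : ‖p‖ < 1) :
    HasDerivAt (fun ε => koebeProd x p ε * koebeProd (p / x) p ε) (-koebeSum x p) 0 := by
  refine ((hasDerivAt_koebeProd x hp).mul (hasDerivAt_koebeProd (p / x) hp)).congr_deriv ?_
  rw [koebeProd_zero, koebeProd_zero, koebeSum]
  ring

lemma qPochhammer_mul_qPochhammer_div {a v p : ℂ} (hv : v ≠ 0) (hp : ‖p‖ < 1)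
    (ha : qPochhammer a p ≠ 0) :
    qPochhammer (a * v) p * qPochhammer (a / v) p =
      qPochhammer a p ^ 2 * koebeProd a p ((v - 1) ^ 2 / v) := by
  have hP := multipliable_one_sub_mul_pow hp
  have hK : Multipliable fun n : ℕ => 1 + (v - 1) ^ 2 / v * -koebe (a * p ^ n) :=
    multipliable_one_add_of_summable ((summable_koebe hp a).neg.mul_left _).norm
  rw [koebeProd, qPochhammer, qPochhammer, qPochhammer, ← (hP _).tprod_mul (hP _), sq,
    ← (hP _).tprod_mul (hP _), ← ((hP _).mul (hP _)).tprod_mul hK]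
  refine tprod_congr fun n => ?_
  have hn := (qPochhammer_ne_zero_iff hp a).mp ha n
  rw [koebe]
  field_simp
  ring

lemma thetaProd_mul_thetaProd_div {x v p : ℂ} (hv : v ≠ 0) (hp : ‖p‖ < 1)
    (hx : thetaProd x p ≠ 0) :
    thetaProd (x * v) p * thetaProd (x / v) p = thetaProd x p ^ 2 *
      (koebeProd x p ((v - 1) ^ 2 / v) * koebeProd (p / x) p ((v - 1) ^ 2 / v)) := by
  have hfst := qPochhammer_mul_qPochhammer_div hv hp (left_ne_zero_of_mul hx)
  have hsnd := qPochhammer_mul_qPochhammer_div hv hp (right_ne_zero_of_mul hx)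
  rw [thetaProd, thetaProd, thetaProd, mul_pow, mul_mul_mul_comm _ _ (koebeProd x p _), ← hfst,
    ← hsnd, ← div_div, div_div_eq_mul_div, div_mul_eq_mul_div]
  ring

lemma thetaProd_sq {v p : ℂ} (hv : v ≠ 0) (hp : ‖p‖ < 1) :
    thetaProd v p ^ 2 =
      (v - 1) ^ 2 * (eulerProd p ^ 2 * koebeProd p p ((v - 1) ^ 2 / v)) ^ 2 := by
  rw [eulerProd, ← qPochhammer_mul_qPochhammer_div hv hp (eulerProd_ne_zero hp), thetaProd,
    qPochhammer_eq_one_sub_mul hp v, mul_comm v p]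
  ring

lemma exists_sub_one_sq_div (ε : ℂ) : ∃ v : ℂ, v ≠ 0 ∧ (v - 1) ^ 2 / v = ε := by
  obtain ⟨s, hs⟩ := IsAlgClosed.exists_pow_nat_eq ((2 + ε) ^ 2 - 4) two_pos
  have hquad : ((2 + ε + s) / 2) ^ 2 - (2 + ε) * ((2 + ε + s) / 2) + 1 = 0 := by
    linear_combination hs / 4
  generalize (2 + ε + s) / 2 = v at hquad
  have hv : v ≠ 0 := by
    rintro rfl
    simp at hquad
  exact ⟨v, hv, by rw [div_eq_iff hv]; linear_combination hquad⟩

section Difference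

variable {x y p : ℂ} (hx : x ≠ 0) (hy : y ≠ 0) (hp : p ≠ 0) (hp1 : ‖p‖ < 1)
  (hθx : thetaProd x p ≠ 0) (hθy : thetaProd y p ≠ 0)
include hx hy hp hp1 hθx hθy

lemma koebeProd_sub (ε : ℂ) :
    koebeProd x p ε * koebeProd (p / x) p ε - koebeProd y p ε * koebeProd (p / y) p ε =
      y * eulerProd p ^ 4 * (thetaProd (x * y) p * thetaProd (x / y) p) /
        (thetaProd x p * thetaProd y p) ^ 2 * (ε * koebeProd p p ε ^ 2) := by
  obtain ⟨v, hv, hε⟩ := exists_sub_one_sq_div ε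
  have hxv := thetaProd_mul_thetaProd_div hv hp1 hθx
  have hyv := thetaProd_mul_thetaProd_div hv hp1 hθy
  have hvsq := thetaProd_sq hv hp1
  have hinv : x * thetaProd (v / x) p = -(v * thetaProd (x / v) p) := by
    rw [thetaProd_eq_of_mul_eq_one hp1 (y := x / v) (by field_simp)]
    field_simp
  have hthree := thetaProd_three_term hx hy hv hp hp1
  rw [hε] at hxv hyv hvsq
  rw [div_eq_iff hv] at hε
  rw [hε] at hvsq
  rw [div_mul_eq_mul_div, eq_div_iff (pow_ne_zero 2 (mul_ne_zero hθx hθy))]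
  apply mul_left_cancel₀ hv
  rw [hvsq, mul_comm v x] at hthree
  linear_combination -hthree - v * thetaProd y p ^ 2 * hxv + v * thetaProd x p ^ 2 * hyv +
    thetaProd (x * v) p * thetaProd y p ^ 2 * hinv

/-- The multiplicative form of `℘(u) - ℘(v) = -σ(u + v) σ(u - v) / (σ(u) ^ 2 σ(v) ^ 2)`, obtained by
comparing the derivatives of both sides of `koebeProd_sub` at `ε = 0`. -/
theorem koebeSum_sub :
    koebeSum y p - koebeSum x p =
      y * eulerProd p ^ 4 * (thetaProd (x * y) p * thetaProd (x / y) p) /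
        (thetaProd x p * thetaProd y p) ^ 2 := by
  have hleft := (hasDerivAt_koebeProd_mul_koebeProd x hp1).sub
    (hasDerivAt_koebeProd_mul_koebeProd y hp1)
  have hright := ((hasDerivAt_id (0 : ℂ)).mul ((hasDerivAt_koebeProd p hp1).pow 2)).const_mul
    (y * eulerProd p ^ 4 * (thetaProd (x * y) p * thetaProd (x / y) p) /
      (thetaProd x p * thetaProd y p) ^ 2)
  have hderiv := hleft.unique <| hright.congr_of_eventuallyEq <|
    Eventually.of_forall (koebeProd_sub hx hy hp hp1 hθx hθy)
  simpa [koebeProd_zero, sub_eq_add_neg, add_comm] using hderiv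

end Difference

/-! ### Eta quotients of level 10 -/

lemma ramanujanThetaTerm_eq_thetaTerm {a : ℂ} (ha : a ≠ 0) (b : ℂ) (n : ℤ) :
    ramanujanThetaTerm a b n = thetaTerm (-a) (a * b) n := by
  rw [ramanujanThetaTerm, thetaTerm, mul_comm n (n + 1), triangle_succ, zpow_add₀ ha, neg_neg,
    mul_zpow]
  ring

lemma ramanujanTheta_eq_thetaProd {a b : ℂ} (ha : a ≠ 0) (hb : b ≠ 0) (hab : ‖a * b‖ < 1) :
    ramanujanTheta a b = eulerProd (a * b) * thetaProd (-a) (a * b) := by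
  simp only [ramanujanTheta, ramanujanThetaTerm_eq_thetaTerm ha b]
  exact tsum_thetaTerm (neg_ne_zero.mpr ha) (mul_ne_zero ha hb) hab

lemma summable_ramanujanThetaTerm {a b : ℂ} (ha : a ≠ 0) (hb : b ≠ 0) (hab : ‖a * b‖ < 1) :
    Summable (ramanujanThetaTerm a b) :=
  (summable_thetaTerm (neg_ne_zero.mpr ha) (mul_ne_zero ha hb) hab).congr fun n =>
    (ramanujanThetaTerm_eq_thetaTerm ha b n).symm

lemma thetaProd_mul_neg {p : ℂ} (hp : ‖p‖ < 1) (x : ℂ) :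
    thetaProd x p * thetaProd (-x) p = thetaProd (x ^ 2) (p ^ 2) := by
  rw [thetaProd, thetaProd, thetaProd, ← qPochhammer_mul_neg hp, ← div_pow,
    ← qPochhammer_mul_neg hp, div_neg]
  ring

section EtaQuotients

variable {q : ℂ} (hq : q ≠ 0) (hq1 : ‖q‖ < 1)

include hq1

lemma eulerProd_pow_ne_zero (k : ℕ) [NeZero k] : eulerProd (q ^ k) ≠ 0 :=
  eulerProd_ne_zero (norm_pow_lt_one hq1 k)

lemma qPochhammer_sq_nome : qPochhammer q (q ^ 2) = eulerProd q / eulerProd (q ^ 2) := by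
  rw [eq_div_iff (eulerProd_pow_ne_zero hq1 2), eulerProd, eulerProd,
    qPochhammer_eq_prod_residues hq1 q 2]
  simp only [prod_range_succ, prod_range_zero, pow_zero, pow_one, mul_one, one_mul, sq]

lemma qPochhammer_neg_sq_nome :
    qPochhammer (-q) (q ^ 2) = eulerProd (q ^ 2) ^ 2 / (eulerProd q * eulerProd (q ^ 4)) := by
  have hE := eulerProd_ne_zero hq1
  have hE2 := eulerProd_pow_ne_zero hq1 2
  have hE4 := eulerProd_pow_ne_zero hq1 4
  have hmul := qPochhammer_mul_neg (norm_pow_lt_one hq1 2) q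
  rw [qPochhammer_sq_nome hq1, qPochhammer_sq_nome (norm_pow_lt_one hq1 2)] at hmul
  simp only [← pow_mul, Nat.reduceMul] at hmul
  field_simp at hmul ⊢
  exact hmul

include hq

lemma thetaProd_sq_nome : thetaProd q (q ^ 2) = (eulerProd q / eulerProd (q ^ 2)) ^ 2 := by
  rw [thetaProd, sq q, mul_div_cancel_right₀ q hq, ← sq q, ← sq, qPochhammer_sq_nome hq1]

lemma ramanujanPhi_neg : ramanujanPhi (-q) = eulerProd q ^ 2 / eulerProd (q ^ 2) := by
  have hE2 := eulerProd_pow_ne_zero hq1 2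
  have hsq : -q * -q = q ^ 2 := by ring
  rw [ramanujanPhi, ramanujanTheta_eq_thetaProd (neg_ne_zero.mpr hq) (neg_ne_zero.mpr hq)
    (hsq ▸ norm_pow_lt_one hq1 2), hsq, neg_neg, thetaProd_sq_nome hq hq1]
  field_simp

lemma ramanujanPsi_eq : ramanujanPsi q = eulerProd (q ^ 2) ^ 2 / eulerProd q := by
  have hE4 := eulerProd_pow_ne_zero hq1 4
  have hfour : q * q ^ 3 = q ^ 4 := by ring
  have hres : thetaProd (-q) (q ^ 4) = qPochhammer (-q) (q ^ 2) := by
    rw [qPochhammer_eq_prod_residues (norm_pow_lt_one hq1 2) (-q) 2]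
    simp only [thetaProd, prod_range_succ, prod_range_zero, pow_zero, mul_one, one_mul,
      ← pow_mul, Nat.reduceMul]
    congr 2
    field_simp
  rw [ramanujanPsi, ramanujanTheta_eq_thetaProd hq (pow_ne_zero 3 hq)
    (hfour ▸ norm_pow_lt_one hq1 4), hfour, hres, qPochhammer_neg_sq_nome hq1]
  field_simp

lemma thetaProd_five_mul :
    thetaProd q (q ^ 5) * thetaProd (q ^ 2) (q ^ 5) = eulerProd q / eulerProd (q ^ 5) := by
  rw [eq_div_iff (eulerProd_pow_ne_zero hq1 5), eulerProd, eulerProd,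
    qPochhammer_eq_prod_residues hq1 q 5, thetaProd, thetaProd,
    show q ^ 5 / q = q ^ 4 by field_simp, show q ^ 5 / q ^ 2 = q ^ 3 by field_simp]
  simp only [prod_range_succ, prod_range_zero, one_mul, ← pow_succ', Nat.reduceAdd, pow_one]
  ring

lemma thetaProd_ten_even_mul : thetaProd (q ^ 2) (q ^ 10) * thetaProd (q ^ 4) (q ^ 10) =
    eulerProd (q ^ 2) / eulerProd (q ^ 10) := by
  simpa only [← pow_mul, Nat.reduceMul] using
    thetaProd_five_mul (pow_ne_zero 2 hq) (norm_pow_lt_one hq1 2)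

lemma thetaProd_five_neg_mul : thetaProd (-q) (q ^ 5) * thetaProd (-q ^ 2) (q ^ 5) =
    eulerProd (q ^ 2) * eulerProd (q ^ 5) / (eulerProd q * eulerProd (q ^ 10)) := by
  have hE := eulerProd_ne_zero hq1
  have hE5 := eulerProd_pow_ne_zero hq1 5
  have hE10 := eulerProd_pow_ne_zero hq1 10
  have hodd := thetaProd_mul_neg (norm_pow_lt_one hq1 5) q
  have heven := thetaProd_mul_neg (norm_pow_lt_one hq1 5) (q ^ 2)
  have hmul := thetaProd_five_mul hq hq1
  have hten := thetaProd_ten_even_mul hq hq1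
  simp only [← pow_mul, Nat.reduceMul] at hodd heven
  rw [← hodd, ← heven, mul_mul_mul_comm, hmul] at hten
  field_simp at hten ⊢
  exact hten

lemma thetaProd_ten_odd_mul : thetaProd q (q ^ 10) * thetaProd (q ^ 3) (q ^ 10) =
    eulerProd q * eulerProd (q ^ 10) / (eulerProd (q ^ 2) * eulerProd (q ^ 5)) := by
  have hE2 := eulerProd_pow_ne_zero hq1 2
  have hE5 := eulerProd_pow_ne_zero hq1 5
  have hE10 := eulerProd_pow_ne_zero hq1 10
  have hfive := qPochhammer_sq_nome (norm_pow_lt_one hq1 5)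
  have hres := qPochhammer_eq_prod_residues (norm_pow_lt_one hq1 2) q 5
  rw [qPochhammer_sq_nome hq1] at hres
  simp only [prod_range_succ, prod_range_zero, mul_one, one_mul, ← pow_mul, ← pow_succ',
    Nat.reduceMul, Nat.reduceAdd] at hres hfive
  rw [hfive] at hres
  rw [thetaProd, thetaProd, show q ^ 10 / q = q ^ 9 by field_simp,
    show q ^ 10 / q ^ 3 = q ^ 7 by field_simp]
  field_simp at hres ⊢
  linear_combination -hres

end EtaQuotients

section FifthRoots

variable {ζ : ℂ} (hζ : IsPrimitiveRoot ζ 5)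

include hζ

lemma geom_sum_fifthRoot : 1 + ζ + ζ ^ 2 + ζ ^ 3 + ζ ^ 4 = 0 := by
  simpa [sum_range_succ] using hζ.geom_sum_eq_zero (by norm_num)

lemma gaussSum_fifthRoot_sq : (ζ - ζ ^ 2 - ζ ^ 3 + ζ ^ 4) ^ 2 = 5 := by
  linear_combination (ζ ^ 4 - 3 * ζ ^ 3 + ζ ^ 2 + 5 * ζ - 5) * geom_sum_fifthRoot hζ

lemma qPochhammer_fifthRoots {a p : ℂ} (hp : ‖p‖ < 1) (ha : qPochhammer a p ≠ 0) :
    (qPochhammer (ζ * a) p * qPochhammer (ζ ^ 4 * a) p) *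
        (qPochhammer (ζ ^ 2 * a) p * qPochhammer (ζ ^ 3 * a) p) =
      qPochhammer (a ^ 5) (p ^ 5) / qPochhammer a p := by
  rw [eq_div_iff ha, ← prod_qPochhammer_rootsOfUnity hζ hp]
  simp only [prod_range_succ, prod_range_zero, pow_zero, pow_one, one_mul]
  ring

lemma div_fifthRoot (a : ℂ) : a / ζ = ζ ^ 4 * a := by
  rw [div_eq_iff (hζ.ne_zero (by norm_num))]
  linear_combination -a * hζ.pow_eq_one

lemma div_fifthRoot_sq (a : ℂ) : a / ζ ^ 2 = ζ ^ 3 * a := by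
  rw [div_eq_iff (pow_ne_zero 2 (hζ.ne_zero (by norm_num)))]
  linear_combination -a * hζ.pow_eq_one

lemma thetaProd_fifthRoot_mul {p : ℂ} (hp : ‖p‖ < 1) :
    thetaProd ζ p * thetaProd (ζ ^ 2) p =
      (1 - ζ) * (1 - ζ ^ 2) * (eulerProd (p ^ 5) / eulerProd p) := by
  rw [thetaProd, thetaProd, div_fifthRoot hζ, div_fifthRoot_sq hζ, eulerProd, eulerProd,
    ← qPochhammer_fifthRoots hζ hp (eulerProd_ne_zero hp), qPochhammer_eq_one_sub_mul hp ζ,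
    qPochhammer_eq_one_sub_mul hp (ζ ^ 2)]
  ring

lemma thetaProd_neg_fifthRoot_mul {q : ℂ} (hq1 : ‖q‖ < 1) :
    thetaProd (-ζ) q * thetaProd (-ζ ^ 2) q =
      -ζ ^ 4 * (eulerProd q * eulerProd (q ^ 10) / (eulerProd (q ^ 2) * eulerProd (q ^ 5))) := by
  have hE := eulerProd_ne_zero hq1
  have hE2 := eulerProd_pow_ne_zero hq1 2
  have hE5 := eulerProd_pow_ne_zero hq1 5
  have hκ : (1 - ζ) * (1 - ζ ^ 2) ≠ 0 :=
    mul_ne_zero (sub_ne_zero.mpr (hζ.ne_one (by norm_num)).symm)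
      (sub_ne_zero.mpr (hζ.pow_ne_one_of_pos_of_lt two_ne_zero (by norm_num)).symm)
  have hinv : thetaProd ((ζ ^ 2) ^ 2) (q ^ 2) = -(ζ ^ 2) ^ 2 * thetaProd ζ (q ^ 2) :=
    thetaProd_eq_of_mul_eq_one (norm_pow_lt_one hq1 2) (by linear_combination hζ.pow_eq_one)
  have hmul := thetaProd_fifthRoot_mul hζ hq1
  have hmul2 := thetaProd_fifthRoot_mul hζ (norm_pow_lt_one hq1 2)
  have hneg := congrArg₂ (· * ·) (thetaProd_mul_neg hq1 ζ) (thetaProd_mul_neg hq1 (ζ ^ 2))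
  simp only [← pow_mul, Nat.reduceMul] at hmul2 hneg hinv
  rw [mul_mul_mul_comm, hmul, hinv, mul_comm (thetaProd (ζ ^ 2) _), mul_assoc (-ζ ^ 4), hmul2]
    at hneg
  apply mul_left_cancel₀ hκ
  field_simp at hneg ⊢
  linear_combination hneg

variable {q : ℂ} (hq : q ≠ 0) (hq1 : ‖q‖ < 1)

include hq hq1

lemma thetaProd_fifthRoot_nome_mul : thetaProd (ζ * q) (q ^ 2) * thetaProd (ζ ^ 2 * q) (q ^ 2) =
    eulerProd (q ^ 2) * eulerProd (q ^ 5) / (eulerProd q * eulerProd (q ^ 10)) := by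
  have hE := eulerProd_ne_zero hq1
  have hE2 := eulerProd_pow_ne_zero hq1 2
  have hsq : q ^ 2 / q = q := by field_simp
  have hne : qPochhammer q (q ^ 2) ≠ 0 := qPochhammer_sq_nome hq1 ▸ div_ne_zero hE hE2
  have hfive := qPochhammer_sq_nome (norm_pow_lt_one hq1 5)
  simp only [← pow_mul, Nat.reduceMul] at hfive
  rw [thetaProd, thetaProd, mul_comm ζ, mul_comm (ζ ^ 2), ← div_div, ← div_div, hsq,
    div_fifthRoot hζ, div_fifthRoot_sq hζ, mul_comm q, mul_comm q,
    qPochhammer_fifthRoots hζ (norm_pow_lt_one hq1 2) hne, qPochhammer_sq_nome hq1, ← pow_mul,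
    hfive]
  field_simp

/-- The three-term relation at `(x, y, u, p) = (ζ ^ 2 q, q, ζ ^ 4, q ^ 2)`. -/
lemma thetaProd_fifthRoot_relation :
    (thetaProd (ζ * q) (q ^ 2) * thetaProd (ζ ^ 2 * q) (q ^ 2)) ^ 2 -
      thetaProd (ζ * q) (q ^ 2) * thetaProd (ζ ^ 2 * q) (q ^ 2) * thetaProd q (q ^ 2) ^ 2 =
      q * (ζ * (thetaProd ζ (q ^ 2) * thetaProd (ζ ^ 2) (q ^ 2))) ^ 2 := by
  have hζ5 := hζ.pow_eq_one
  have hζ0 := hζ.ne_zero (by norm_num)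
  have hp := pow_ne_zero 2 hq
  have hp1 := norm_pow_lt_one hq1 2
  have hxy : thetaProd (ζ ^ 2 * q * q) (q ^ 2) = thetaProd (ζ ^ 3) (q ^ 2) :=
    thetaProd_eq_of_mul_eq_nome hp (by linear_combination q ^ 2 * hζ5)
  have hyu : thetaProd (q * ζ ^ 4) (q ^ 2) = thetaProd (ζ * q) (q ^ 2) :=
    thetaProd_eq_of_mul_eq_nome hp (by linear_combination q ^ 2 * hζ5)
  have hx : thetaProd (ζ ^ 3 * q) (q ^ 2) = thetaProd (ζ ^ 2 * q) (q ^ 2) :=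
    thetaProd_eq_of_mul_eq_nome hp (by linear_combination q ^ 2 * hζ5)
  have hxu : ζ ^ 2 * q * thetaProd (ζ ^ 4 / (ζ ^ 2 * q)) (q ^ 2) =
      -ζ ^ 4 * thetaProd (ζ ^ 2 * q) (q ^ 2) := by
    rw [thetaProd_eq_of_mul_eq_one hp1 (y := ζ ^ 3 * q) (by field_simp; linear_combination hζ5),
      hx, ← mul_assoc, mul_neg, mul_div_cancel₀ (ζ ^ 4) (by simp [hζ0, hq])]
  have hcube : thetaProd (ζ ^ 3) (q ^ 2) = -ζ ^ 3 * thetaProd (ζ ^ 2) (q ^ 2) :=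
    thetaProd_eq_of_mul_eq_one hp1 (by linear_combination hζ5)
  have hu : thetaProd (ζ ^ 4) (q ^ 2) = -ζ ^ 4 * thetaProd ζ (q ^ 2) :=
    thetaProd_eq_of_mul_eq_one hp1 (by linear_combination hζ5)
  have hthree := thetaProd_three_term (mul_ne_zero (pow_ne_zero 2 hζ0) hq) hq
    (pow_ne_zero 4 hζ0) hp hp1
  rw [hxy, hyu, hcube, hu, mul_div_cancel_right₀ _ hq,
    show q / ζ ^ 4 = ζ * q by rw [div_eq_iff (pow_ne_zero 4 hζ0)]; linear_combination -q * hζ5,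
    show ζ ^ 4 * (ζ ^ 2 * q) = ζ * q by linear_combination ζ * q * hζ5] at hthree
  apply mul_left_cancel₀ (pow_ne_zero 4 hζ0)
  linear_combination hthree - thetaProd (ζ * q) (q ^ 2) * thetaProd q (q ^ 2) ^ 2 * hxu +
    q * ζ ^ 6 * (thetaProd ζ (q ^ 2) * thetaProd (ζ ^ 2) (q ^ 2)) ^ 2 * hζ5

end FifthRoots

section EtaQuotientRelations

variable {q : ℂ} (hq : q ≠ 0) (hq1 : ‖q‖ < 1)

include hq hq1

/-- The three-term relation at `(x, y, u, p) = (q ^ 3, q ^ 5, q ^ 4, q ^ 10)`. -/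
lemma thetaProd_ten_relation :
    (thetaProd (q ^ 2) (q ^ 10) * thetaProd (q ^ 4) (q ^ 10)) ^ 2 -
      q * (thetaProd q (q ^ 10) * thetaProd (q ^ 3) (q ^ 10)) ^ 2 =
      thetaProd q (q ^ 10) * thetaProd (q ^ 3) (q ^ 10) * thetaProd (q ^ 5) (q ^ 10) ^ 2 := by
  have hp1 := norm_pow_lt_one hq1 10
  have hrefl (k l : ℕ) (hkl : k + l = 10) :
      thetaProd (q ^ k) (q ^ 10) = thetaProd (q ^ l) (q ^ 10) :=
    thetaProd_eq_of_mul_eq_nome (pow_ne_zero 10 hq) (by rw [← pow_add, hkl])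
  have hinv : q ^ 2 * thetaProd (q ^ 3 / q ^ 5) (q ^ 10) = -thetaProd (q ^ 2) (q ^ 10) := by
    rw [thetaProd_eq_of_mul_eq_one hp1 (y := q ^ 2) (by field_simp)]
    field_simp
  have hthree := thetaProd_three_term (pow_ne_zero 3 hq) (pow_ne_zero 5 hq) (pow_ne_zero 4 hq)
    (pow_ne_zero 10 hq) hp1
  rw [← pow_add, ← pow_add, ← pow_add, show q ^ 5 / q ^ 4 = q by field_simp,
    show q ^ 4 / q ^ 3 = q by field_simp, hrefl (3 + 5) 2 rfl,
    hrefl (5 + 4) 1 rfl, hrefl (4 + 3) 3 rfl, pow_one] at hthree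
  apply mul_left_cancel₀ (pow_ne_zero 3 hq)
  linear_combination -hthree + q ^ 3 * thetaProd (q ^ 2) (q ^ 10) *
    thetaProd (q ^ 4) (q ^ 10) ^ 2 * hinv

lemma ramanujanPsi_sq_sub :
    ramanujanPsi q ^ 2 - q * ramanujanPsi (q ^ 5) ^ 2 =
      eulerProd (q ^ 2) * eulerProd (q ^ 5) ^ 3 / (eulerProd q * eulerProd (q ^ 10)) := by
  have hE := eulerProd_ne_zero hq1
  have hE2 := eulerProd_pow_ne_zero hq1 2
  have hE5 := eulerProd_pow_ne_zero hq1 5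
  have hE10 := eulerProd_pow_ne_zero hq1 10
  have hfive := thetaProd_sq_nome (pow_ne_zero 5 hq) (norm_pow_lt_one hq1 5)
  have hrel := thetaProd_ten_relation hq hq1
  simp only [← pow_mul, Nat.reduceMul] at hfive
  rw [thetaProd_ten_even_mul hq hq1, thetaProd_ten_odd_mul hq hq1, hfive] at hrel
  rw [ramanujanPsi_eq hq hq1, ramanujanPsi_eq (pow_ne_zero 5 hq) (norm_pow_lt_one hq1 5),
    ← pow_mul]
  field_simp at hrel ⊢
  linear_combination hrel

lemma ramanujanPsi_sq_sub_five :
    ramanujanPsi q ^ 2 - 5 * q * ramanujanPsi (q ^ 5) ^ 2 =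
      eulerProd q ^ 3 * eulerProd (q ^ 10) / (eulerProd (q ^ 2) * eulerProd (q ^ 5)) := by
  have hE := eulerProd_ne_zero hq1
  have hE2 := eulerProd_pow_ne_zero hq1 2
  have hE5 := eulerProd_pow_ne_zero hq1 5
  have hE10 := eulerProd_pow_ne_zero hq1 10
  obtain ⟨ζ, hζ⟩ := HasEnoughRootsOfUnity.exists_primitiveRoot ℂ 5
  have hκ : (ζ * ((1 - ζ) * (1 - ζ ^ 2))) ^ 2 = 5 := by
    rw [← gaussSum_fifthRoot_sq hζ]
    ring
  have hrel := thetaProd_fifthRoot_relation hζ hq hq1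
  rw [thetaProd_fifthRoot_nome_mul hζ hq hq1, thetaProd_sq_nome hq hq1,
    thetaProd_fifthRoot_mul hζ (norm_pow_lt_one hq1 2), ← mul_assoc ζ, mul_pow _ (_ / _), hκ,
    ← pow_mul] at hrel
  rw [ramanujanPsi_eq hq hq1, ramanujanPsi_eq (pow_ne_zero 5 hq) (norm_pow_lt_one hq1 5),
    ← pow_mul]
  norm_num only at hrel ⊢
  field_simp at hrel ⊢
  linear_combination hrel

end EtaQuotientRelations

section KoebeSumDifferences

variable {q : ℂ} (hq : q ≠ 0) (hq1 : ‖q‖ < 1)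

include hq hq1

lemma koebeSum_ten_sub : koebeSum q (q ^ 10) - koebeSum (q ^ 3) (q ^ 10) =
    q * eulerProd (q ^ 2) ^ 3 * eulerProd (q ^ 5) ^ 2 * eulerProd (q ^ 10) /
      eulerProd q ^ 2 := by
  have hE := eulerProd_ne_zero hq1
  have hE2 := eulerProd_pow_ne_zero hq1 2
  have hE5 := eulerProd_pow_ne_zero hq1 5
  have hE10 := eulerProd_pow_ne_zero hq1 10
  have hodd := thetaProd_ten_odd_mul hq hq1
  have hθ : thetaProd q (q ^ 10) * thetaProd (q ^ 3) (q ^ 10) ≠ 0 := by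
    rw [hodd]
    positivity
  rw [koebeSum_sub (pow_ne_zero 3 hq) hq (pow_ne_zero 10 hq) (norm_pow_lt_one hq1 10)
    (right_ne_zero_of_mul hθ) (left_ne_zero_of_mul hθ), ← pow_succ,
    show q ^ 3 / q = q ^ 2 by field_simp, mul_comm (thetaProd (q ^ (3 + 1)) _),
    thetaProd_ten_even_mul hq hq1, mul_comm (thetaProd (q ^ 3) _), hodd]
  field_simp

lemma koebeSum_five_sub : koebeSum (-q) (q ^ 5) - koebeSum (-q ^ 2) (q ^ 5) =
    -(q * eulerProd q ^ 3 * eulerProd (q ^ 5) * eulerProd (q ^ 10) ^ 2 /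
      eulerProd (q ^ 2) ^ 2) := by
  have hE := eulerProd_ne_zero hq1
  have hE2 := eulerProd_pow_ne_zero hq1 2
  have hE5 := eulerProd_pow_ne_zero hq1 5
  have hE10 := eulerProd_pow_ne_zero hq1 10
  have hneg := thetaProd_five_neg_mul hq hq1
  have hθ : thetaProd (-q) (q ^ 5) * thetaProd (-q ^ 2) (q ^ 5) ≠ 0 := by
    rw [hneg]
    positivity
  have hrefl : thetaProd (-q ^ 2 * -q) (q ^ 5) = thetaProd (q ^ 2) (q ^ 5) :=
    thetaProd_eq_of_mul_eq_nome (pow_ne_zero 5 hq) (by ring)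
  rw [koebeSum_sub (neg_ne_zero.mpr (pow_ne_zero 2 hq)) (neg_ne_zero.mpr hq) (pow_ne_zero 5 hq)
    (norm_pow_lt_one hq1 5) (right_ne_zero_of_mul hθ) (left_ne_zero_of_mul hθ), hrefl,
    show -q ^ 2 / -q = q by field_simp, mul_comm (thetaProd (q ^ 2) _),
    thetaProd_five_mul hq hq1, mul_comm (thetaProd (-q ^ 2) _), hneg]
  field_simp

variable {ζ : ℂ} (hζ : IsPrimitiveRoot ζ 5)

include hζ

lemma koebeSum_fifthRoot_nome_sub :
    koebeSum (ζ * q) (q ^ 2) - koebeSum (ζ ^ 2 * q) (q ^ 2) =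
      (ζ - ζ ^ 2 - ζ ^ 3 + ζ ^ 4) * (q * eulerProd q ^ 2 * eulerProd (q ^ 2) *
        eulerProd (q ^ 10) ^ 3 / eulerProd (q ^ 5) ^ 2) := by
  have hE := eulerProd_ne_zero hq1
  have hE2 := eulerProd_pow_ne_zero hq1 2
  have hE5 := eulerProd_pow_ne_zero hq1 5
  have hE10 := eulerProd_pow_ne_zero hq1 10
  have hζ0 := hζ.ne_zero (by norm_num)
  have hnome := thetaProd_fifthRoot_nome_mul hζ hq hq1
  have hθ : thetaProd (ζ * q) (q ^ 2) * thetaProd (ζ ^ 2 * q) (q ^ 2) ≠ 0 := by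
    rw [hnome]
    positivity
  have hrefl : thetaProd (ζ ^ 2 * q * (ζ * q)) (q ^ 2) = thetaProd (ζ ^ 2) (q ^ 2) :=
    thetaProd_eq_of_mul_eq_nome (pow_ne_zero 2 hq) (by linear_combination q ^ 2 * hζ.pow_eq_one)
  have hmul := thetaProd_fifthRoot_mul hζ (norm_pow_lt_one hq1 2)
  simp only [← pow_mul, Nat.reduceMul] at hmul
  rw [koebeSum_sub (mul_ne_zero (pow_ne_zero 2 hζ0) hq) (mul_ne_zero hζ0 hq) (pow_ne_zero 2 hq)
    (norm_pow_lt_one hq1 2) (right_ne_zero_of_mul hθ) (left_ne_zero_of_mul hθ), hrefl,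
    show ζ ^ 2 * q / (ζ * q) = ζ by field_simp, mul_comm (thetaProd (ζ ^ 2) _), hmul,
    mul_comm (thetaProd (ζ ^ 2 * q) _), hnome]
  field_simp
  ring

lemma koebeSum_neg_fifthRoot_sub : koebeSum (-ζ) q - koebeSum (-ζ ^ 2) q =
    (ζ - ζ ^ 2 - ζ ^ 3 + ζ ^ 4) * (eulerProd q * eulerProd (q ^ 2) ^ 2 * eulerProd (q ^ 5) ^ 3 /
      eulerProd (q ^ 10) ^ 2) := by
  have hE := eulerProd_ne_zero hq1
  have hE2 := eulerProd_pow_ne_zero hq1 2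
  have hE5 := eulerProd_pow_ne_zero hq1 5
  have hE10 := eulerProd_pow_ne_zero hq1 10
  have hζ0 := hζ.ne_zero (by norm_num)
  have hneg := thetaProd_neg_fifthRoot_mul hζ hq1
  have hθ : thetaProd (-ζ) q * thetaProd (-ζ ^ 2) q ≠ 0 := by
    rw [hneg, neg_mul, neg_ne_zero]
    positivity
  have hinv : thetaProd (-ζ ^ 2 * -ζ) q = -(-ζ ^ 2 * -ζ) * thetaProd (ζ ^ 2) q :=
    thetaProd_eq_of_mul_eq_one hq1 (by linear_combination hζ.pow_eq_one)
  rw [koebeSum_sub (neg_ne_zero.mpr (pow_ne_zero 2 hζ0)) (neg_ne_zero.mpr hζ0) hq hq1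
    (right_ne_zero_of_mul hθ) (left_ne_zero_of_mul hθ), hinv,
    show -ζ ^ 2 / -ζ = ζ by field_simp, mul_assoc _ (thetaProd _ q), mul_comm (thetaProd (ζ ^ 2) _),
    thetaProd_fifthRoot_mul hζ hq1, mul_comm (thetaProd (-ζ ^ 2) _), hneg]
  field_simp
  linear_combination -(1 - ζ - ζ ^ 2 + ζ ^ 3) * hζ.pow_eq_one

end KoebeSumDifferences

/-! ### Lambert series twisted by the Legendre symbol -/

lemma legendreFive_periodic : Function.Periodic legendreFive 5 := fun n => by
  rw [legendreFive, legendreFive, legendreSym.mod, Nat.cast_add, Int.add_emod_right,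
    ← legendreSym.mod]

lemma legendreFive_mul_gaussSum {ζ : ℂ} (hζ : IsPrimitiveRoot ζ 5) (n : ℕ) :
    legendreFive n * (ζ - ζ ^ 2 - ζ ^ 3 + ζ ^ 4) =
      ζ ^ n - (ζ ^ 2) ^ n - (ζ ^ 3) ^ n + (ζ ^ 4) ^ n := by
  have hζ5 := hζ.pow_eq_one
  have hmod (k : ℕ) : (ζ ^ k) ^ n = (ζ ^ k) ^ (n % 5) := by
    rw [← pow_mul, ← pow_mul, mul_comm, pow_mul, mul_comm, pow_mul, pow_eq_pow_mod n hζ5]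
  rw [← legendreFive_periodic.map_mod_nat n, pow_eq_pow_mod n hζ5, hmod, hmod, hmod]
  have hlt : n % 5 < 5 := Nat.mod_lt n (by norm_num)
  interval_cases n % 5 <;> norm_num [legendreFive]
  · linear_combination (ζ - ζ ^ 3) * hζ5
  · linear_combination (ζ + ζ ^ 4 - ζ ^ 2 * (ζ ^ 5 + 1)) * hζ5
  · linear_combination (ζ ^ 3 + ζ ^ 2 * (ζ ^ 5 + 1) - ζ * (ζ ^ 10 + ζ ^ 5 + 1)) * hζ5

section Periodic

variable {χ : ℕ → ℂ} {k : ℕ} (hχ : Function.Periodic χ k)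

include hχ

lemma summable_periodic_mul [NeZero k] {f : ℕ → ℂ} (hf : Summable f) :
    Summable fun n => χ n * f n := by
  refine Summable.of_norm_bounded (hf.norm.mul_left (∑ r ∈ range k, ‖χ r‖)) fun n => ?_
  rw [norm_mul, ← hχ.map_mod_nat n]
  gcongr
  exact single_le_sum (f := fun r => ‖χ r‖) (fun r _ => norm_nonneg _)
    (mem_range.mpr (Nat.mod_lt n (NeZero.pos k)))

lemma tsum_periodic_mul_koebe [NeZero k] {p : ℂ} (hp : ‖p‖ < 1) (a : ℂ) :
    ∑' n, χ n * koebe (a * p ^ n) =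
      ∑ r ∈ range k, χ r * ∑' m : ℕ, koebe (a * p ^ r * (p ^ k) ^ m) := by
  obtain ⟨l, rfl⟩ := Nat.exists_eq_add_one_of_ne_zero (NeZero.ne k)
  rw [Nat.sumByResidueClasses (summable_periodic_mul hχ (summable_koebe hp a)) (l + 1)]
  refine (Fin.sum_univ_eq_sum_range
    (fun r => ∑' m : ℕ, χ (r + (l + 1) * m) * koebe (a * p ^ (r + (l + 1) * m))) (l + 1)).trans
    (sum_congr rfl fun r _ => ?_)
  rw [← tsum_mul_left]
  refine tsum_congr fun m => ?_
  have hper : χ (r + m * (l + 1)) = χ r := hχ.nsmul m r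
  rw [mul_comm (l + 1), hper, mul_comm m, pow_add, pow_mul, mul_assoc a]

end Periodic

lemma summable_lambert_double {w b : ℂ} (hw : ‖w‖ < 1) (hb : ‖b‖ < 1) :
    Summable fun z : ℕ × ℕ => (z.1 : ℂ) * (w * b ^ z.2) ^ z.1 := by
  have hfst : Summable fun n : ℕ => (n : ℝ) * ‖w‖ ^ n :=
    (hasSum_coe_mul_geometric_of_norm_lt_one (r := ‖w‖) (by simpa using hw)).summable
  have hsnd : Summable fun m : ℕ => ‖b‖ ^ m := summable_geometric_of_lt_one (norm_nonneg b) hb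
  refine Summable.of_norm_bounded (hfst.mul_of_nonneg hsnd (fun n => by positivity)
    fun m => by positivity) fun ⟨n, m⟩ => ?_
  rcases Nat.eq_zero_or_pos n with rfl | hn
  · simp
  · rw [mul_pow, ← pow_mul, norm_mul, norm_mul, ← mul_assoc, norm_pow, norm_pow,
      Complex.norm_natCast]
    exact mul_le_mul_of_nonneg_left
      (pow_le_pow_of_le_one (norm_nonneg b) hb.le (Nat.le_mul_of_pos_right m hn)) (by positivity)

lemma hasSum_lambert {w b : ℂ} (hw : ‖w‖ < 1) (hb : ‖b‖ < 1) :
    HasSum (fun n : ℕ => (n : ℂ) * w ^ n / (1 - b ^ n)) (∑' m : ℕ, koebe (w * b ^ m)) := by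
  have hdouble := summable_lambert_double hw hb
  have hrow (n : ℕ) : ∑' m : ℕ, (n : ℂ) * (w * b ^ m) ^ n = n * w ^ n / (1 - b ^ n) := by
    rcases eq_or_ne n 0 with rfl | hn
    · simp
    · have : NeZero n := ⟨hn⟩
      rw [div_eq_mul_inv, ← tsum_geometric_of_norm_lt_one (norm_pow_lt_one hb n), ← tsum_mul_left]
      exact tsum_congr fun m => by ring
  have hcolumn (m : ℕ) : ∑' n : ℕ, (n : ℂ) * (w * b ^ m) ^ n = koebe (w * b ^ m) := by
    refine tsum_coe_mul_geometric_of_norm_lt_one ?_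
    rw [norm_mul, norm_pow]
    exact mul_lt_one_of_nonneg_of_lt_one_left (norm_nonneg w) hw
      (pow_le_one₀ (norm_nonneg b) hb.le)
  have hsum := hdouble.prod
  simp only [hrow] at hsum
  rw [hsum.hasSum_iff, ← tsum_congr hcolumn, ← tsum_congr hrow]
  exact hdouble.tsum_comm.symm

lemma hasSum_legendreFive_lambert {ζ : ℂ} (hζ : IsPrimitiveRoot ζ 5) {a b : ℂ}
    (ha : ‖a‖ < 1) (hb : ‖b‖ < 1) :
    HasSum (fun n : ℕ => (ζ - ζ ^ 2 - ζ ^ 3 + ζ ^ 4) *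
        (legendreFive n * ((n : ℂ) * a ^ n / (1 - b ^ n))))
      (∑' m : ℕ, koebe (ζ * a * b ^ m) - ∑' m : ℕ, koebe (ζ ^ 2 * a * b ^ m) -
        ∑' m : ℕ, koebe (ζ ^ 3 * a * b ^ m) + ∑' m : ℕ, koebe (ζ ^ 4 * a * b ^ m)) := by
  have hlambert {ω : ℂ} (hω : ‖ω‖ = 1) := hasSum_lambert (w := ω * a) (by simpa [hω]) hb
  have hζ1 : ‖ζ‖ = 1 := hζ.norm'_eq_one (by norm_num)
  have hζk (k : ℕ) : ‖ζ ^ k‖ = 1 := by rw [norm_pow, hζ1, one_pow]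
  refine ((((hlambert hζ1).sub (hlambert (hζk 2))).sub (hlambert (hζk 3))).add
    (hlambert (hζk 4))).congr_fun fun n => ?_
  simp only [mul_pow]
  linear_combination (n : ℂ) * a ^ n / (1 - b ^ n) * legendreFive_mul_gaussSum hζ n

lemma neg_koebe_neg (t : ℂ) : -koebe (-t) = t / (1 + t) ^ 2 := by
  rw [koebe, sub_neg_eq_add, neg_div, neg_neg]

lemma gaussSum_fifthRoot_ne_zero {ζ : ℂ} (hζ : IsPrimitiveRoot ζ 5) :
    ζ - ζ ^ 2 - ζ ^ 3 + ζ ^ 4 ≠ 0 :=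
  ne_zero_pow two_ne_zero (gaussSum_fifthRoot_sq hζ ▸ OfNat.ofNat_ne_zero 5)

lemma koebe_neg_fifthRoot_sub {ζ : ℂ} (hζ : IsPrimitiveRoot ζ 5) :
    koebe (-ζ) - koebe (-ζ ^ 2) = ζ - ζ ^ 2 - ζ ^ 3 + ζ ^ 4 := by
  have hinv : (1 + ζ)⁻¹ = -ζ - ζ ^ 3 :=
    inv_eq_of_mul_eq_one_right (by linear_combination -geom_sum_fifthRoot hζ)
  have hinv_sq : (1 + ζ ^ 2)⁻¹ = -ζ - ζ ^ 2 :=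
    inv_eq_of_mul_eq_one_right (by linear_combination -geom_sum_fifthRoot hζ)
  rw [koebe, koebe, sub_neg_eq_add, sub_neg_eq_add, div_eq_mul_inv, div_eq_mul_inv, ← inv_pow,
    ← inv_pow, hinv, hinv_sq]
  linear_combination (ζ - ζ ^ 2) * hζ.pow_eq_one

lemma tsum_pnat_legendreFive_mul (f : ℕ → ℂ) :
    ∑' n : ℕ+, legendreFive n * f n = ∑' n : ℕ, legendreFive n * f n :=
  tsum_pnat_eq_tsum_of_eq_zero (f := fun n => legendreFive n * f n) (by simp [legendreFive])

section LegendreSums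

variable {q : ℂ} (hq1 : ‖q‖ < 1)

include hq1

lemma summable_legendreFive_div_one_add_sq :
    Summable fun n : ℕ => legendreFive n * (q ^ n / (1 + q ^ n) ^ 2) :=
  summable_periodic_mul legendreFive_periodic <| (summable_koebe hq1 (-1)).neg.congr fun n => by
    rw [neg_one_mul, neg_koebe_neg]

lemma summable_legendreFive_div_one_sub_sq :
    Summable fun n : ℕ => legendreFive n * (q ^ n / (1 - q ^ n) ^ 2) :=
  summable_periodic_mul legendreFive_periodic <| (summable_koebe hq1 1).congr fun n => by
    rw [one_mul, koebe]

lemma summable_legendreFive_lambert {b : ℂ} (hb : ‖b‖ < 1) :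
    Summable fun n : ℕ => legendreFive n * ((n : ℂ) * q ^ n / (1 - b ^ n)) :=
  summable_periodic_mul legendreFive_periodic (hasSum_lambert hq1 hb).summable

lemma tsum_legendreFive_mul_koebe (a : ℂ) :
    ∑' n, legendreFive n * koebe (a * q ^ n) =
      ∑' m : ℕ, koebe (a * q * (q ^ 5) ^ m) - ∑' m : ℕ, koebe (a * q ^ 2 * (q ^ 5) ^ m) -
        ∑' m : ℕ, koebe (a * q ^ 3 * (q ^ 5) ^ m) + ∑' m : ℕ, koebe (a * q ^ 4 * (q ^ 5) ^ m) := by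
  rw [tsum_periodic_mul_koebe legendreFive_periodic hq1]
  norm_num [sum_range_succ, legendreFive]
  ring

lemma tsum_odd_legendreFive_mul_koebe :
    ∑' n : {n : ℕ // Odd n}, legendreFive n * koebe (q ^ (n : ℕ)) =
      ∑' m : ℕ, koebe (q * (q ^ 10) ^ m) - ∑' m : ℕ, koebe (q ^ 3 * (q ^ 10) ^ m) -
        ∑' m : ℕ, koebe (q ^ 7 * (q ^ 10) ^ m) + ∑' m : ℕ, koebe (q ^ 9 * (q ^ 10) ^ m) := by
  have hper : Function.Periodic ({n | Odd n}.indicator legendreFive) 10 := fun n => by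
    have hodd : Odd (n + 10) ↔ Odd n := by grind
    have hten : legendreFive (n + 10) = legendreFive n := legendreFive_periodic.nsmul 2 n
    simp only [Set.indicator_apply, Set.mem_ofPred_eq, hodd, hten]
  have hres := tsum_periodic_mul_koebe hper hq1 1
  simp only [one_mul] at hres
  refine (tsum_subtype {n : ℕ | Odd n} fun n => legendreFive n * koebe (q ^ n)).trans ?_
  simp only [Set.indicator_mul_left]
  rw [hres]
  norm_num [sum_range_succ, legendreFive, Set.indicator_apply, Nat.odd_iff]
  ring

variable (hq : q ≠ 0)

include hq

lemma tsum_legendreFive_div_one_add_sq :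
    ∑' n : ℕ+, legendreFive n * (q ^ (n : ℕ) / (1 + q ^ (n : ℕ)) ^ 2) =
      q * eulerProd q ^ 3 * eulerProd (q ^ 5) * eulerProd (q ^ 10) ^ 2 /
        eulerProd (q ^ 2) ^ 2 := by
  have hsum := tsum_legendreFive_mul_koebe hq1 (-1)
  have hdiff := koebeSum_five_sub hq hq1
  rw [koebeSum, koebeSum, show q ^ 5 / -q = -q ^ 4 by field_simp,
    show q ^ 5 / -q ^ 2 = -q ^ 3 by field_simp] at hdiff
  simp only [neg_one_mul] at hsum
  rw [tsum_pnat_legendreFive_mul fun n => q ^ n / (1 + q ^ n) ^ 2]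
  simp only [← neg_koebe_neg, mul_neg, tsum_neg]
  linear_combination -hsum - hdiff

lemma tsum_odd_legendreFive_div_one_sub_sq :
    ∑' n : {n : ℕ // Odd n}, legendreFive n * (q ^ (n : ℕ) / (1 - q ^ (n : ℕ)) ^ 2) =
      q * eulerProd (q ^ 2) ^ 3 * eulerProd (q ^ 5) ^ 2 * eulerProd (q ^ 10) /
        eulerProd q ^ 2 := by
  have hsum := tsum_odd_legendreFive_mul_koebe hq1
  have hdiff := koebeSum_ten_sub hq hq1
  rw [koebeSum, koebeSum, show q ^ 10 / q = q ^ 9 by field_simp,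
    show q ^ 10 / q ^ 3 = q ^ 7 by field_simp] at hdiff
  simp only [koebe] at hsum hdiff
  linear_combination hsum + hdiff

lemma tsum_legendreFive_lambert :
    ∑' n : ℕ+, legendreFive n * ((n : ℂ) * q ^ (n : ℕ) / (1 - q ^ (2 * (n : ℕ)))) =
      q * eulerProd q ^ 2 * eulerProd (q ^ 2) * eulerProd (q ^ 10) ^ 3 /
        eulerProd (q ^ 5) ^ 2 := by
  obtain ⟨ζ, hζ⟩ := HasEnoughRootsOfUnity.exists_primitiveRoot ℂ 5
  have hsum := (hasSum_legendreFive_lambert hζ hq1 (norm_pow_lt_one hq1 2)).tsum_eq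
  have hdiff := koebeSum_fifthRoot_nome_sub hq hq1 hζ
  have hsq : q ^ 2 / q = q := by field_simp
  rw [koebeSum, koebeSum, mul_comm ζ, mul_comm (ζ ^ 2), ← div_div, ← div_div, hsq,
    div_fifthRoot hζ, div_fifthRoot_sq hζ, mul_comm q, mul_comm q] at hdiff
  rw [tsum_mul_left] at hsum
  rw [tsum_pnat_legendreFive_mul fun n => (n : ℂ) * q ^ n / (1 - q ^ (2 * n))]
  simp only [pow_mul]
  apply mul_left_cancel₀ (gaussSum_fifthRoot_ne_zero hζ)
  linear_combination hsum + hdiff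

lemma one_add_tsum_legendreFive_lambert_neg :
    1 + ∑' n : ℕ+, legendreFive n * ((n : ℂ) * (-q) ^ (n : ℕ) / (1 - q ^ (n : ℕ))) =
      eulerProd q * eulerProd (q ^ 2) ^ 2 * eulerProd (q ^ 5) ^ 3 / eulerProd (q ^ 10) ^ 2 := by
  obtain ⟨ζ, hζ⟩ := HasEnoughRootsOfUnity.exists_primitiveRoot ℂ 5
  have hsum := (hasSum_legendreFive_lambert hζ (a := -q) (by rwa [norm_neg]) hq1).tsum_eq
  have hdiff := koebeSum_neg_fifthRoot_sub hq hq1 hζ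
  have hfirst (a : ℂ) : ∑' m : ℕ, koebe (-a * q ^ m) =
      koebe (-a) + ∑' m : ℕ, koebe (a * -q * q ^ m) := by
    rw [(summable_koebe hq1 (-a)).tsum_eq_zero_add, pow_zero, mul_one]
    congr! 4 with m
    ring
  rw [koebeSum, koebeSum, div_neg, div_neg, div_fifthRoot hζ, div_fifthRoot_sq hζ, hfirst ζ,
    hfirst (ζ ^ 2), ← mul_neg, ← mul_neg] at hdiff
  rw [tsum_mul_left] at hsum
  rw [tsum_pnat_legendreFive_mul fun n => (n : ℂ) * (-q) ^ n / (1 - q ^ n)]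
  apply mul_left_cancel₀ (gaussSum_fifthRoot_ne_zero hζ)
  linear_combination hsum + hdiff - koebe_neg_fifthRoot_sub hζ

end LegendreSums

lemma ramanujanThetaTerm_zero {k : ℕ} (hk : k ≠ 0) {n : ℤ} (hn : n ≠ 0) :
    ramanujanThetaTerm 0 (0 ^ k) n = 0 := by
  rw [ramanujanThetaTerm, zero_pow hk, mul_comm n (n + 1), triangle_succ]
  rcases eq_or_ne (n * (n - 1) / 2) 0 with h | h
  · rw [h, zero_add, zero_zpow n hn, zero_mul]
  · rw [zero_zpow _ h, mul_zero]

lemma summable_ramanujanThetaTerm_pow {q : ℂ} (hq1 : ‖q‖ < 1) (k : ℕ) [NeZero k] :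
    Summable (ramanujanThetaTerm q (q ^ k)) := by
  rcases eq_or_ne q 0 with rfl | hq
  · exact summable_of_ne_finset_zero (s := {0}) fun n hn =>
      ramanujanThetaTerm_zero (NeZero.ne k) (by simpa using hn)
  · refine summable_ramanujanThetaTerm hq (pow_ne_zero k hq) ?_
    rw [← pow_succ']
    exact norm_pow_lt_one hq1 (k + 1)

lemma ramanujanPhi_zero : ramanujanPhi 0 = 1 := by
  have hterm (n : ℤ) (hn : n ≠ 0) : ramanujanThetaTerm 0 0 n = 0 := by
    simpa using ramanujanThetaTerm_zero one_ne_zero hn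
  rw [ramanujanPhi, ramanujanTheta, tsum_eq_single 0 hterm]
  simp [ramanujanThetaTerm]

section Expansions

variable {q : ℂ} (hq : q ≠ 0) (hq1 : ‖q‖ < 1)

include hq hq1

lemma ramanujanPhi_neg_mul_cube : ramanujanPhi (-q) * ramanujanPhi (-q ^ 5) ^ 3 =
    1 + ∑' n : ℕ+, legendreFive n * ((n : ℂ) * (-q) ^ (n : ℕ) / (1 - q ^ (n : ℕ))) -
      ∑' n : ℕ+, legendreFive n * (q ^ (n : ℕ) / (1 + q ^ (n : ℕ)) ^ 2) := by
  have hE := eulerProd_ne_zero hq1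
  have hE2 := eulerProd_pow_ne_zero hq1 2
  have hE5 := eulerProd_pow_ne_zero hq1 5
  have hE10 := eulerProd_pow_ne_zero hq1 10
  have hrel := ramanujanPsi_sq_sub hq hq1
  rw [ramanujanPsi_eq hq hq1, ramanujanPsi_eq (pow_ne_zero 5 hq) (norm_pow_lt_one hq1 5)] at hrel
  rw [one_add_tsum_legendreFive_lambert_neg hq1 hq, tsum_legendreFive_div_one_add_sq hq1 hq,
    ramanujanPhi_neg hq hq1, ramanujanPhi_neg (pow_ne_zero 5 hq) (norm_pow_lt_one hq1 5)]
  simp only [← pow_mul, Nat.reduceMul] at hrel ⊢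
  field_simp at hrel ⊢
  linear_combination -hrel

lemma ramanujanPhi_neg_cube_mul : ramanujanPhi (-q) ^ 3 * ramanujanPhi (-q ^ 5) =
    1 + ∑' n : ℕ+, legendreFive n * ((n : ℂ) * (-q) ^ (n : ℕ) / (1 - q ^ (n : ℕ))) -
      5 * ∑' n : ℕ+, legendreFive n * (q ^ (n : ℕ) / (1 + q ^ (n : ℕ)) ^ 2) := by
  have hE := eulerProd_ne_zero hq1
  have hE2 := eulerProd_pow_ne_zero hq1 2
  have hE5 := eulerProd_pow_ne_zero hq1 5
  have hE10 := eulerProd_pow_ne_zero hq1 10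
  have hrel := ramanujanPsi_sq_sub_five hq hq1
  rw [ramanujanPsi_eq hq hq1, ramanujanPsi_eq (pow_ne_zero 5 hq) (norm_pow_lt_one hq1 5)] at hrel
  rw [one_add_tsum_legendreFive_lambert_neg hq1 hq, tsum_legendreFive_div_one_add_sq hq1 hq,
    ramanujanPhi_neg hq hq1, ramanujanPhi_neg (pow_ne_zero 5 hq) (norm_pow_lt_one hq1 5)]
  simp only [← pow_mul, Nat.reduceMul] at hrel ⊢
  field_simp at hrel ⊢
  linear_combination -hrel

lemma tsum_legendreFive_lambert_eq_ramanujanPsi :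
    ∑' n : ℕ+, legendreFive n * ((n : ℂ) * q ^ (n : ℕ) / (1 - q ^ (2 * (n : ℕ)))) =
      q * ramanujanPsi q * ramanujanPsi (q ^ 5) *
        (ramanujanPsi q ^ 2 - 5 * q * ramanujanPsi (q ^ 5) ^ 2) := by
  have hE := eulerProd_ne_zero hq1
  have hE2 := eulerProd_pow_ne_zero hq1 2
  have hE5 := eulerProd_pow_ne_zero hq1 5
  rw [ramanujanPsi_sq_sub_five hq hq1, tsum_legendreFive_lambert hq1 hq, ramanujanPsi_eq hq hq1,
    ramanujanPsi_eq (pow_ne_zero 5 hq) (norm_pow_lt_one hq1 5)]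
  simp only [← pow_mul, Nat.reduceMul]
  field_simp

lemma tsum_odd_legendreFive_eq_ramanujanPsi :
    ∑' n : {n : ℕ // Odd n}, legendreFive n * (q ^ (n : ℕ) / (1 - q ^ (n : ℕ)) ^ 2) =
      q * ramanujanPsi q * ramanujanPsi (q ^ 5) *
        (ramanujanPsi q ^ 2 - q * ramanujanPsi (q ^ 5) ^ 2) := by
  have hE := eulerProd_ne_zero hq1
  have hE5 := eulerProd_pow_ne_zero hq1 5
  have hE10 := eulerProd_pow_ne_zero hq1 10
  rw [ramanujanPsi_sq_sub hq hq1, tsum_odd_legendreFive_div_one_sub_sq hq1 hq,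
    ramanujanPsi_eq hq hq1, ramanujanPsi_eq (pow_ne_zero 5 hq) (norm_pow_lt_one hq1 5)]
  simp only [← pow_mul, Nat.reduceMul]
  field_simp

end Expansions

theorem corollary7p3 (q : ℂ) (hq : ‖q‖ < 1) :
    -- the theta series and the Lambert series converge absolutely
    (Summable (fun n : ℤ => ramanujanThetaTerm q q n) ∧
      Summable (fun n : ℤ => ramanujanThetaTerm q (q ^ 3) n) ∧
      Summable (fun n : ℕ+ => legendreFive n * ((n : ℂ) * q ^ (n : ℕ) / (1 - (-q) ^ (n : ℕ)))) ∧
      Summable (fun n : ℕ+ => legendreFive n * ((-q) ^ (n : ℕ) / (1 + (-q) ^ (n : ℕ)) ^ 2)) ∧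
      Summable (fun n : ℕ+ => legendreFive n * ((n : ℂ) * q ^ (n : ℕ) / (1 - q ^ (2 * (n : ℕ))))) ∧
      Summable (fun n : {n : ℕ // Odd n} =>
        legendreFive n * (q ^ (n : ℕ) / (1 - q ^ (n : ℕ)) ^ 2))) ∧
    -- the four expansions
    ramanujanPhi q * ramanujanPhi (q ^ 5) ^ 3 =
      1 + ∑' n : ℕ+, legendreFive n * ((n : ℂ) * q ^ (n : ℕ) / (1 - (-q) ^ (n : ℕ)))
        - ∑' n : ℕ+, legendreFive n * ((-q) ^ (n : ℕ) / (1 + (-q) ^ (n : ℕ)) ^ 2) ∧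
    ramanujanPhi q ^ 3 * ramanujanPhi (q ^ 5) =
      1 + ∑' n : ℕ+, legendreFive n * ((n : ℂ) * q ^ (n : ℕ) / (1 - (-q) ^ (n : ℕ)))
        - 5 * ∑' n : ℕ+, legendreFive n * ((-q) ^ (n : ℕ) / (1 + (-q) ^ (n : ℕ)) ^ 2) ∧
    4 * q * ramanujanPsi q ^ 3 * ramanujanPsi (q ^ 5) =
      -(∑' n : ℕ+, legendreFive n * ((n : ℂ) * q ^ (n : ℕ) / (1 - q ^ (2 * (n : ℕ)))))
        + 5 * ∑' n : {n : ℕ // Odd n},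
            legendreFive n * (q ^ (n : ℕ) / (1 - q ^ (n : ℕ)) ^ 2) ∧
    4 * q ^ 2 * ramanujanPsi q * ramanujanPsi (q ^ 5) ^ 3 =
      -(∑' n : ℕ+, legendreFive n * ((n : ℂ) * q ^ (n : ℕ) / (1 - q ^ (2 * (n : ℕ)))))
        + ∑' n : {n : ℕ // Odd n},
            legendreFive n * (q ^ (n : ℕ) / (1 - q ^ (n : ℕ)) ^ 2) := by
  have hneg : ‖-q‖ < 1 := by rwa [norm_neg]
  have hA := summable_legendreFive_lambert hq hneg
  have hS := summable_legendreFive_div_one_add_sq hneg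
  have hT := summable_legendreFive_lambert hq (norm_pow_lt_one hq 2)
  have hB := summable_legendreFive_div_one_sub_sq hq
  simp only [← pow_mul] at hT
  refine ⟨⟨by simpa using summable_ramanujanThetaTerm_pow hq 1,
    summable_ramanujanThetaTerm_pow hq 3, hA.comp_injective PNat.coe_injective,
    hS.comp_injective PNat.coe_injective, hT.comp_injective PNat.coe_injective,
    hB.comp_injective Subtype.coe_injective⟩, ?_⟩
  rcases eq_or_ne q 0 with rfl | hq0
  · have hodd (n : {n : ℕ // Odd n}) : (n : ℕ) ≠ 0 := n.2.pos.ne'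
    simp [ramanujanPhi_zero, hodd]
  have hφ := ramanujanPhi_neg_mul_cube (neg_ne_zero.mpr hq0) hneg
  have hφ' := ramanujanPhi_neg_cube_mul (neg_ne_zero.mpr hq0) hneg
  rw [neg_neg, Odd.neg_pow (by decide : Odd 5) q, neg_neg] at hφ hφ'
  rw [tsum_legendreFive_lambert_eq_ramanujanPsi hq0 hq,
    tsum_odd_legendreFive_eq_ramanujanPsi hq0 hq]
  exact ⟨hφ, hφ', by ring, by ring⟩
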